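/- Let $\mathbb D$ be the open unit disc in $\mathbb C$ and $dA$ Lebesgue measure on $\mathbb D$. For a nondegenerate subarc $I$ of the unit circle $\partial\mathbb D$ (the full circle allowed), let $|I|\in(0,1]$ be its normalized arc length (so $|\partial\mathbb D|=1$), and let $$S(I)=\Big\{z\in\mathbb D:\ 1-|I|<|z|<1,\ \tfrac{z}{|z|}\in I\Big\}.$$ For $t>0$ let $\mathcal Q_t$ be the space of holomorphic functions $f$ on $\mathbb D$ with $$\|f\|_{\mathcal Q_t}=|f(0)|+\sup_{a\in\mathbb D}\Big(\int_{\mathbb D}|f'(z)|^2\big(1-|\varphi_a(z)|^2\big)^t\,dA(z)\Big)^{1/2}<\infty,\qquad \varphi_a(z)=\frac{a-z}{1-\overline a z}.$$ For $s>0$ and a positive Borel measure $\mu$ on $\mathbb D$ let $\mathcal T^2_{s,2}(\mu)$ be the space of holomorphic functions $f$ on $\mathbb D$ with $$\|f\|_{\mathcal T^2_{s,2}(\mu)}=\sup_{I\subseteq\partial\mathbb D}\Big(\frac{1}{|I|^s\big(\log\frac{2}{|I|}\big)^2}\int_{S(I)}|f(z)|^2\,d\mu(z)\Big)^{1/2}<\infty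 .$$ **Theorem.** Let $0<t<s\le 1$ and let $\mu$ be a positive Borel measure on $\mathbb D$. Then the identity map $\mathrm{id}:\mathcal Q_t\to\mathcal T^2_{s,2}(\mu)$ is bounded, that is, $\mathcal Q_t\subseteq\mathcal T^2_{s,2}(\mu)$ and there is a constant $C<\infty$ with $\|f\|_{\mathcal T^2_{s,2}(\mu)}\le C\,\|f\|_{\mathcal Q_t}$ for all $f\in\mathcal Q_t$, if and only if $\mu$ is an $s$-Carleson measure, that is, $$\sup_{I\subseteq\partial\mathbb D}\frac{\mu(S(I))}{|I|^s}<\infty .$$ -/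

import Mathlib

open MeasureTheory
open scoped ENNReal NNReal

noncomputable section

namespace CarlesonEmbedding

/-- The open unit disc of the complex plane. -/
def disc : Set ℂ := Metric.ball (0 : ℂ) 1

/-- A nondegenerate subarc of the unit circle, running counterclockwise from `exp (i lo)` to
`exp (i hi)`.  Each of its two endpoints may or may not belong to it, and the full circle is
allowed. -/
structure Subarc where
  lo : ℝ
  hi : ℝ
  lo_lt_hi : lo < hi
  hi_le : hi ≤ lo + 2 * Real.pi
  /-- the points of the arc -/
  carrier : Set ℂ
  Ioo_subset : (fun θ : ℝ => Complex.exp (θ * Complex.I)) '' Set.Ioo lo hi ⊆ carrier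
  subset_Icc : carrier ⊆ (fun θ : ℝ => Complex.exp (θ * Complex.I)) '' Set.Icc lo hi

/-- The normalized arc length `|I| ∈ (0, 1]`; the full circle has length `1`. -/
def Subarc.length (I : Subarc) : ℝ := (I.hi - I.lo) / (2 * Real.pi)

/-- The Carleson tent `S(I) = {z ∈ 𝔻 : 1 - |I| < |z| < 1, z / |z| ∈ I}`.  (The point `0` never
belongs to it, because `|I| ≤ 1`.) -/
def Subarc.tent (I : Subarc) : Set ℂ :=
  {z | 1 - I.length < ‖z‖ ∧ ‖z‖ < 1 ∧ z / (‖z‖ : ℂ) ∈ I.carrier}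

/-- `φ_a(z) = (a - z) / (1 - conj a * z)`. -/
def discAut (a z : ℂ) : ℂ := (a - z) / (1 - (starRingEnd ℂ) a * z)

/-- The norm of `𝒬_s`,
`|f(0)| + sup_{a ∈ 𝔻} (∫_𝔻 |f'(z)|² (1 - |φ_a(z)|²)^s dA(z))^{1/2}`, as an extended real. -/
def qNorm (s : ℝ) (f : ℂ → ℂ) : ℝ≥0∞ :=
  ‖f 0‖ₑ + ⨆ a ∈ disc,
    (∫⁻ z in disc, ENNReal.ofReal (‖deriv f z‖ ^ 2 * (1 - ‖discAut a z‖ ^ 2) ^ s)) ^ (1 / 2 : ℝ)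

/-- The space `𝒬_s` of holomorphic functions on the unit disc with finite `𝒬_s` norm.  (Values
of `f` outside the disc are irrelevant.) -/
def QSpace (s : ℝ) : Set (ℂ → ℂ) := {f | DifferentiableOn ℂ f disc ∧ qNorm s f < ∞}

/-- The norm of the logarithmic tent space `𝒯^p_{s,p}(μ)`,
`sup_I (|I|^{-s} (log (2 / |I|))^{-p} ∫_{S(I)} |f|^p dμ)^{1/p}`, as an extended real. -/
def tentNorm (s p : ℝ) (μ : Measure ℂ) (f : ℂ → ℂ) : ℝ≥0∞ :=
  ⨆ I : Subarc,
    ((∫⁻ z in I.tent, ‖f z‖ₑ ^ p ∂μ) /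
      ENNReal.ofReal (I.length ^ s * Real.log (2 / I.length) ^ p)) ^ (1 / p)

/-- The logarithmic tent space `𝒯^p_{s,p}(μ)` of holomorphic functions on the unit disc. -/
def TentSpace (s p : ℝ) (μ : Measure ℂ) : Set (ℂ → ℂ) :=
  {f | DifferentiableOn ℂ f disc ∧ tentNorm s p μ f < ∞}

/-- `μ` is an `s`-Carleson measure: `sup_I μ(S(I)) / |I|^s < ∞`. -/
def IsCarlesonMeasure (s : ℝ) (μ : Measure ℂ) : Prop :=
  (⨆ I : Subarc, μ I.tent / ENNReal.ofReal (I.length ^ s)) < ∞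

/-- The identity map from `𝒬_t` to `𝒯^p_{s,p}(μ)` is (well defined and) bounded. -/
def IdBounded (t s p : ℝ) (μ : Measure ℂ) : Prop :=
  QSpace t ⊆ TentSpace s p μ ∧
    ∃ C : ℝ≥0, ∀ f ∈ QSpace t, tentNorm s p μ f ≤ C * qNorm t f

end CarlesonEmbedding

end

/-! Sufficiency. On a tent of side `L = |I|`, compare `f(z)` with its value at the radial projection
of `z` to the circle of radius `1 - L`. Functions in `𝒬_t` satisfy a Bloch estimate, so the
projected value is at most a multiple of `log (2 / L)` times the norm (`norm_le_log`). Its square is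
what the logarithmic factor of the tent norm absorbs.

The oscillation needs no logarithm (`lintegral_tent_oscillation_le`). Join the two points by a chain
along the radius with steps of size `δ_k = L 2^{-k}`. Each step is controlled by the Dirichlet
integral of `f` over a Whitney disc, and a Cauchy-Schwarz inequality with geometric weights `q^k`,
`q = 2^{-(s-t)}`, sums the steps (`enorm_sub_radial_sq_le`). Integrate in `μ` and exchange the
integrals: `|f'(w)|²` is then weighted by the `μ`-measure of the points whose chain sees `w`, which
is `O(δ_k^s)` by the Carleson condition (`measure_shadow_le`). The weight `q^{-k}` turns `δ_k^s`
into `L^{s-t} δ_k^t`. Only scales `δ_k ≤ 4 (1 - |w|)` occur, so the sum is `O(L^{s-t} (1 - |w|)^t)`,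
hence `O(L^s (1 - |φ_a(w)|²)^t)` with `a` the apex of the tent: the `𝒬_t` integrand. The gap `t < s`
makes the Cauchy-Schwarz weights summable, and `t > 0` does the same for the scales.

Necessity. The functions `log 16 - log (1 - conj b * z)` are bounded in `𝒬_t` uniformly in `b`
(`exists_qNorm_logTest_le`). With `b` the apex of `I`, the modulus is at least `log (2 / |I|)` on
the tent (`log_le_norm_logTest`), so the logarithms cancel and the Carleson condition remains. -/

namespace CarlesonEmbedding

/-! ### Mean value inequalities and local Dirichlet estimates -/

/-- Integration over the plane in polar coordinates. -/
lemma lintegral_eq_polar {f : ℂ → ℝ≥0∞} (hf : Measurable f) :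
    ∫⁻ z, f z = ∫⁻ r in Set.Ioi (0 : ℝ), ENNReal.ofReal r *
      ∫⁻ θ in Set.Ioo (-Real.pi) Real.pi, f (r * Complex.exp (θ * Complex.I)) := by
  rw [← Complex.lintegral_comp_polarCoord_symm]
  have hm : Measurable fun p : ℝ × ℝ => f (p.1 * Complex.exp (p.2 * Complex.I)) := by
    apply hf.comp; fun_prop
  have h1 : ∀ p : ℝ × ℝ, ENNReal.ofReal p.1 • f (Complex.polarCoord.symm p) =
      ENNReal.ofReal p.1 * f (p.1 * Complex.exp (p.2 * Complex.I)) := by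
    intro p
    rw [Complex.polarCoord_symm_apply, Complex.exp_mul_I, smul_eq_mul]
    simp
  simp_rw [h1]
  rw [polarCoord_target, Measure.volume_eq_prod, ← Measure.prod_restrict, lintegral_prod]
  · refine lintegral_congr fun r => ?_
    exact lintegral_const_mul' _ _ ENNReal.ofReal_ne_top
  · exact ((ENNReal.measurable_ofReal.comp measurable_fst).mul hm).aemeasurable

/-- The function `g²` is itself holomorphic, so its mean value property and the triangle inequality
for integrals suffice; no subharmonicity is needed. -/
lemma two_pi_mul_enorm_sq_le_lintegral_circle {g : ℂ → ℂ} {z : ℂ} {R ρ : ℝ}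
    (hg : DifferentiableOn ℂ g (Metric.ball z R)) (hρ : 0 < ρ) (hρR : ρ < R) :
    ENNReal.ofReal (2 * Real.pi) * ‖g z‖ₑ ^ 2 ≤
      ∫⁻ θ in Set.Ioo (-Real.pi) Real.pi, ‖g (z + ρ * Complex.exp (θ * Complex.I))‖ₑ ^ 2 := by
  have hd : DiffContOnCl ℂ (fun w => g w ^ 2) (Metric.ball z |ρ|) := by
    rw [abs_of_pos hρ]
    apply DifferentiableOn.diffContOnCl
    rw [closure_ball _ hρ.ne']
    exact (hg.mono (Metric.closedBall_subset_ball hρR)).pow 2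
  have h := hd.circleAverage
  have hpi := Real.pi_pos
  rw [Real.circleAverage] at h
  -- Periodicity moves the circle average from `[0, 2π]` to the interval `(-π, π)` of the polar
  -- chart.
  have hper : Function.Periodic (fun θ : ℝ => g (circleMap z ρ θ) ^ 2) (2 * Real.pi) := by
    intro θ; simp [periodic_circleMap z ρ θ]
  have h2 : ∫ θ in (0 : ℝ)..(2 * Real.pi), g (circleMap z ρ θ) ^ 2 =
      ∫ θ in (-Real.pi)..Real.pi, g (circleMap z ρ θ) ^ 2 := by
    have := hper.intervalIntegral_add_eq 0 (-Real.pi)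
    rw [zero_add] at this
    rw [this]; congr 1; ring
  rw [h2, intervalIntegral.integral_of_le (by linarith), integral_Ioc_eq_integral_Ioo] at h
  have h3 : ((2 * Real.pi : ℝ) : ℂ) * g z ^ 2 =
      ∫ θ in Set.Ioo (-Real.pi) Real.pi, g (circleMap z ρ θ) ^ 2 := by
    rw [← h, Complex.real_smul, ← mul_assoc, ← Complex.ofReal_mul, mul_inv_cancel₀ (by positivity)]
    simp
  have h4 := enorm_integral_le_lintegral_enorm (μ := volume.restrict (Set.Ioo (-Real.pi) Real.pi))
    (fun θ : ℝ => g (circleMap z ρ θ) ^ 2)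
  rw [← h3] at h4
  simp only [enorm_mul, enorm_pow] at h4
  have h5 : ‖((2 * Real.pi : ℝ) : ℂ)‖ₑ = ENNReal.ofReal (2 * Real.pi) := by
    rw [← ofReal_norm, Complex.norm_real, Real.norm_of_nonneg (by positivity)]
  rw [h5] at h4
  exact h4

/-- The area mean value inequality for the squared modulus of a holomorphic function. -/
lemma enorm_sq_le_lintegral_ball {g : ℂ → ℂ} (hgm : Measurable g) {z : ℂ} {r : ℝ} (hr : 0 ≤ r)
    (hg : DifferentiableOn ℂ g (Metric.ball z r)) :
    ENNReal.ofReal (Real.pi * r ^ 2) * ‖g z‖ₑ ^ 2 ≤ ∫⁻ w in Metric.ball z r, ‖g w‖ₑ ^ 2 := by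
  set F : ℂ → ℝ≥0∞ := (Metric.ball z r).indicator fun w => ‖g w‖ₑ ^ 2 with hF
  have hFm : Measurable F :=
    (hgm.enorm.pow_const 2).indicator measurableSet_ball
  rw [← lintegral_indicator measurableSet_ball, ← lintegral_add_left_eq_self F z,
    lintegral_eq_polar (f := fun x => F (z + x)) (hFm.comp (measurable_const_add z))]
  have key : ∀ ρ ∈ Set.Ioi (0 : ℝ), (Set.Ioo 0 r).indicator
      (fun ρ => ENNReal.ofReal ρ * (ENNReal.ofReal (2 * Real.pi) * ‖g z‖ₑ ^ 2)) ρ ≤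
      ENNReal.ofReal ρ * ∫⁻ θ in Set.Ioo (-Real.pi) Real.pi,
        F (z + ρ * Complex.exp (θ * Complex.I)) := by
    intro ρ hρ
    by_cases h : ρ ∈ Set.Ioo 0 r
    · rw [Set.indicator_of_mem h]
      gcongr
      refine (two_pi_mul_enorm_sq_le_lintegral_circle hg h.1 h.2).trans_eq ?_
      refine lintegral_congr fun θ => ?_
      rw [hF, Set.indicator_of_mem]
      simp [Complex.norm_exp_ofReal_mul_I, abs_of_pos h.1, h.2]
    · rw [Set.indicator_of_notMem h]; exact zero_le
  refine le_trans ?_ (setLIntegral_mono' measurableSet_Ioi key)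
  rw [setLIntegral_indicator measurableSet_Ioo, Set.inter_eq_left.2 (fun x hx => hx.1),
    lintegral_mul_const _ ENNReal.measurable_ofReal]
  have h6 : ∫⁻ ρ in Set.Ioo 0 r, ENNReal.ofReal ρ = ENNReal.ofReal (r ^ 2 / 2) := by
    rw [restrict_Ioo_eq_restrict_Ioc, ← ofReal_integral_eq_lintegral_ofReal,
      ← intervalIntegral.integral_of_le hr, integral_id]
    · simp
    · exact (continuous_id.intervalIntegrable 0 r).1
    · filter_upwards [ae_restrict_mem measurableSet_Ioc] with x hx using hx.1.le
  rw [h6, ← mul_assoc, ← ENNReal.ofReal_mul (by positivity)]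
  apply le_of_eq; congr 2; ring

/-- The increment of a holomorphic function over a ball is controlled by its Dirichlet integral
over a larger concentric ball. -/
lemma enorm_sub_sq_le_lintegral_deriv {f : ℂ → ℂ} {x y : ℂ} {δ : ℝ} (hδ : 0 < δ)
    (hf : DifferentiableOn ℂ f (Metric.ball x (3 * δ / 4))) (hy : ‖y - x‖ ≤ δ / 2) :
    ‖f y - f x‖ₑ ^ 2 ≤ 2 * ∫⁻ w in Metric.ball x (3 * δ / 4), ‖deriv f w‖ₑ ^ 2 := by
  set A := ∫⁻ w in Metric.ball x (3 * δ / 4), ‖deriv f w‖ₑ ^ 2 with hA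
  rcases eq_or_ne A ∞ with h | h
  · rw [h]; simp
  have hpi := Real.pi_gt_three
  have hsub : Metric.closedBall x (δ / 2) ⊆ Metric.ball x (3 * δ / 4) :=
    Metric.closedBall_subset_ball (by linarith)
  -- Apply the area mean value inequality to `f'` on the disc of radius `δ / 4` about `p`, which
  -- still fits in the larger ball. With `π > 3` the constant is `16 / 3`, rounded up to `8`.
  have hb : ∀ p ∈ Metric.closedBall x (δ / 2), ‖deriv f p‖ ≤ √(A.toReal * 8) / δ := by
    intro p hp
    have hs : Metric.ball p (δ / 4) ⊆ Metric.ball x (3 * δ / 4) := by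
      apply Metric.ball_subset_ball'
      rw [Metric.mem_closedBall] at hp; linarith
    have h1 := enorm_sq_le_lintegral_ball (measurable_deriv f) (by linarith : 0 ≤ δ / 4)
      ((hf.deriv Metric.isOpen_ball).mono hs)
    have h2 := h1.trans (lintegral_mono_set hs)
    rw [← hA, ← ENNReal.ofReal_toReal h, ← ofReal_norm, ← ENNReal.ofReal_pow (norm_nonneg _),
      ← ENNReal.ofReal_mul (by positivity), ENNReal.ofReal_le_ofReal_iff ENNReal.toReal_nonneg] at h2
    rw [le_div_iff₀ hδ]
    apply Real.le_sqrt_of_sq_le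
    have : 3 * (δ / 4) ^ 2 * ‖deriv f p‖ ^ 2 ≤ Real.pi * (δ / 4) ^ 2 * ‖deriv f p‖ ^ 2 := by gcongr
    nlinarith [sq_nonneg (δ * ‖deriv f p‖)]
  have h3 := Convex.norm_image_sub_le_of_norm_deriv_le
    (fun p hp => (hf.differentiableAt (Metric.isOpen_ball.mem_nhds (hsub hp)))) hb
    (convex_closedBall x (δ / 2)) (Metric.mem_closedBall_self (by linarith))
    (by rwa [Metric.mem_closedBall, dist_eq_norm] : y ∈ Metric.closedBall x (δ / 2))
  have h4 : ‖f y - f x‖ ≤ √(A.toReal * 8) / 2 := by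
    refine h3.trans ?_
    calc √(A.toReal * 8) / δ * ‖y - x‖ ≤ √(A.toReal * 8) / δ * (δ / 2) := by gcongr
      _ = _ := by field_simp
  have h5 : ‖f y - f x‖ ^ 2 ≤ 2 * A.toReal := by
    calc ‖f y - f x‖ ^ 2 ≤ (√(A.toReal * 8) / 2) ^ 2 := by gcongr
      _ = _ := by rw [div_pow, Real.sq_sqrt (by positivity)]; ring
  rw [← ofReal_norm, ← ENNReal.ofReal_pow (norm_nonneg _), ← ENNReal.ofReal_toReal h]
  refine (ENNReal.ofReal_le_ofReal h5).trans_eq ?_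
  rw [ENNReal.ofReal_mul (by norm_num)]; simp

/-! ### The Möbius weight and the growth of functions in `𝒬_t` -/

lemma mem_disc {z : ℂ} : z ∈ disc ↔ ‖z‖ < 1 := by simp [disc]

lemma norm_one_sub_conj_mul_pos {a z : ℂ} (ha : ‖a‖ < 1) (hz : ‖z‖ < 1) :
    0 < ‖1 - (starRingEnd ℂ) a * z‖ := by
  have h : ‖(starRingEnd ℂ) a * z‖ < 1 := by
    rw [norm_mul, RCLike.norm_conj]
    nlinarith [norm_nonneg a, norm_nonneg z]
  have := norm_sub_norm_le (1 : ℂ) ((starRingEnd ℂ) a * z)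
  rw [norm_one] at this
  linarith

lemma one_sub_norm_discAut_sq {a z : ℂ} (ha : ‖a‖ < 1) (hz : ‖z‖ < 1) :
    1 - ‖discAut a z‖ ^ 2 =
      (1 - ‖a‖ ^ 2) * (1 - ‖z‖ ^ 2) / ‖1 - (starRingEnd ℂ) a * z‖ ^ 2 := by
  have hp := norm_one_sub_conj_mul_pos ha hz
  rw [discAut, norm_div, div_pow, eq_div_iff (by positivity), sub_mul, one_mul,
    div_mul_cancel₀ _ (by positivity)]
  simp only [← Complex.normSq_eq_norm_sq, Complex.normSq_apply, Complex.sub_re, Complex.sub_im,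
    Complex.mul_re, Complex.mul_im, Complex.conj_re, Complex.conj_im, Complex.one_re,
    Complex.one_im]
  ring

/-- This rests on `1 - conj a * w = (1 - |a|²) + conj a * (a - w)`: near `a`, at distances
comparable to `1 - |a|`, the denominator of `φ_a` is itself `O(1 - |a|)`. -/
lemma norm_one_sub_conj_mul_le {a w : ℂ} (ha : ‖a‖ ≤ 1) :
    ‖1 - (starRingEnd ℂ) a * w‖ ≤ 2 * (1 - ‖a‖) + ‖a - w‖ := by
  have h : 1 - (starRingEnd ℂ) a * w = ((1 - ‖a‖ ^ 2 : ℝ) : ℂ) + (starRingEnd ℂ) a * (a - w) := by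
    rw [mul_sub, Complex.conj_mul']; push_cast; ring
  rw [h]
  refine (norm_add_le _ _).trans ?_
  rw [Complex.norm_real, norm_mul, RCLike.norm_conj,
    Real.norm_of_nonneg (by nlinarith [norm_nonneg a])]
  have := mul_le_of_le_one_left (norm_nonneg (a - w)) ha
  nlinarith [norm_nonneg a]

/-- On a disc of radius comparable to `1 - ‖a‖`, the weight of `𝒬_t` at `a` dominates
`((1 - ‖w‖) / (1 - ‖a‖))^t`. -/
lemma one_sub_norm_le_mul_one_sub_discAut {a w : ℂ} {K : ℝ} (ha : ‖a‖ < 1) (hw : ‖w‖ < 1)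
    (h : ‖1 - (starRingEnd ℂ) a * w‖ ≤ K * (1 - ‖a‖)) :
    1 - ‖w‖ ≤ K ^ 2 * (1 - ‖a‖) * (1 - ‖discAut a w‖ ^ 2) := by
  have hp := norm_one_sub_conj_mul_pos ha hw
  rw [one_sub_norm_discAut_sq ha hw, mul_div_assoc', le_div_iff₀ (by positivity)]
  have ha0 := norm_nonneg a
  have hw0 := norm_nonneg w
  have ha1 : 0 < 1 - ‖a‖ := by linarith
  have hw1 : 0 < 1 - ‖w‖ := by linarith
  calc (1 - ‖w‖) * ‖1 - (starRingEnd ℂ) a * w‖ ^ 2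
      ≤ (1 - ‖w‖) * (K * (1 - ‖a‖)) ^ 2 := by gcongr
    _ = K ^ 2 * (1 - ‖a‖) * ((1 - ‖a‖) * (1 - ‖w‖)) := by ring
    _ ≤ K ^ 2 * (1 - ‖a‖) * ((1 - ‖a‖ ^ 2) * (1 - ‖w‖ ^ 2)) := by
        gcongr <;> nlinarith

lemma one_sub_norm_discAut_sq_nonneg {a z : ℂ} (ha : ‖a‖ < 1) (hz : ‖z‖ < 1) :
    0 ≤ 1 - ‖discAut a z‖ ^ 2 := by
  rw [one_sub_norm_discAut_sq ha hz]
  have ha0 := norm_nonneg a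
  have hz0 := norm_nonneg z
  have : 0 ≤ 1 - ‖a‖ ^ 2 := by nlinarith
  have : 0 ≤ 1 - ‖z‖ ^ 2 := by nlinarith
  positivity

lemma lintegral_deriv_discAut_le (t : ℝ) (f : ℂ → ℂ) {a : ℂ} (ha : ‖a‖ < 1) :
    ∫⁻ z in disc, ‖deriv f z‖ₑ ^ 2 * ENNReal.ofReal ((1 - ‖discAut a z‖ ^ 2) ^ t) ≤
      qNorm t f ^ 2 := by
  have h : (∫⁻ z in disc, ENNReal.ofReal (‖deriv f z‖ ^ 2 * (1 - ‖discAut a z‖ ^ 2) ^ t)) ^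
      (1 / 2 : ℝ) ≤ qNorm t f :=
    (le_iSup₂ (f := fun a (_ : a ∈ disc) => (∫⁻ z in disc, ENNReal.ofReal
      (‖deriv f z‖ ^ 2 * (1 - ‖discAut a z‖ ^ 2) ^ t)) ^ (1 / 2 : ℝ)) a (mem_disc.2 ha)).trans
      le_add_self
  have h2 := ENNReal.rpow_le_rpow h (by norm_num : (0 : ℝ) ≤ 2)
  rw [← ENNReal.rpow_mul, one_div, inv_mul_cancel₀ (by norm_num), ENNReal.rpow_one,
    ENNReal.rpow_two] at h2
  refine le_trans (le_of_eq (lintegral_congr fun z => ?_)) h2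
  rw [ENNReal.ofReal_mul (by positivity), ENNReal.ofReal_pow (norm_nonneg _), ofReal_norm]

/-- Functions in `𝒬_t` satisfy the Bloch growth condition. -/
lemma one_sub_norm_mul_norm_deriv_le {t : ℝ} (ht : 0 < t) {f : ℂ → ℂ} (hf : f ∈ QSpace t) {z : ℂ}
    (hz : ‖z‖ < 1) :
    (1 - ‖z‖) * ‖deriv f z‖ ≤ 2 * (25 / 2 : ℝ) ^ t * (qNorm t f).toReal := by
  set d := 1 - ‖z‖ with hd
  have hd0 : 0 < d := by linarith
  have hsub : Metric.ball z (d / 2) ⊆ disc := by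
    intro w hw
    rw [Metric.mem_ball, dist_eq_norm] at hw
    rw [mem_disc]
    linarith [norm_le_norm_add_norm_sub' w z]
  have h1 := enorm_sq_le_lintegral_ball (measurable_deriv f) (by linarith : 0 ≤ d / 2)
    ((hf.1.deriv Metric.isOpen_ball).mono hsub)
  set K : ℝ := (25 / 2 : ℝ) ^ t with hK
  have hK1 : 1 ≤ K := Real.one_le_rpow (by norm_num) ht.le
  have h2 : ∫⁻ w in Metric.ball z (d / 2), ‖deriv f w‖ₑ ^ 2 ≤
      ENNReal.ofReal K * qNorm t f ^ 2 := by
    calc ∫⁻ w in Metric.ball z (d / 2), ‖deriv f w‖ₑ ^ 2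
        ≤ ∫⁻ w in Metric.ball z (d / 2), ENNReal.ofReal K *
          (‖deriv f w‖ₑ ^ 2 * ENNReal.ofReal ((1 - ‖discAut z w‖ ^ 2) ^ t)) := by
          apply setLIntegral_mono' measurableSet_ball
          intro w hw
          have hw1 := mem_disc.1 (hsub hw)
          rw [Metric.mem_ball, dist_eq_norm, norm_sub_rev] at hw
          have hn := norm_one_sub_conj_mul_le (w := w) hz.le
          -- The weight is centred at `z` itself. On the disc of radius `d / 2` the denominator is
          -- at most `2d + d/2`, whence `K = 5/2`; together with `1 - |w| ≥ d / 2` this gives the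
          -- constant `2 K² = 25/2`.
          have h3 := one_sub_norm_le_mul_one_sub_discAut (K := 5 / 2) hz hw1 (by linarith)
          have h4 : d / 2 ≤ 1 - ‖w‖ := by
            linarith [norm_le_norm_add_norm_sub z w]
          have h5 : 1 ≤ (25 / 2 : ℝ) * (1 - ‖discAut z w‖ ^ 2) := by
            rw [← hd] at h3
            have : d * 1 ≤ d * ((25 / 2 : ℝ) * (1 - ‖discAut z w‖ ^ 2)) := by
              nlinarith
            exact le_of_mul_le_mul_left this hd0
          have h6 : 1 ≤ K * (1 - ‖discAut z w‖ ^ 2) ^ t := by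
            rw [hK, ← Real.mul_rpow (by norm_num) (one_sub_norm_discAut_sq_nonneg hz hw1)]
            exact Real.one_le_rpow h5 ht.le
          rw [mul_left_comm, ← ENNReal.ofReal_mul (by positivity)]
          exact le_mul_of_one_le_right zero_le (by simpa using h6)
      _ ≤ ∫⁻ w in disc, ENNReal.ofReal K *
          (‖deriv f w‖ₑ ^ 2 * ENNReal.ofReal ((1 - ‖discAut z w‖ ^ 2) ^ t)) :=
          lintegral_mono_set hsub
      _ = ENNReal.ofReal K * ∫⁻ w in disc,
          (‖deriv f w‖ₑ ^ 2 * ENNReal.ofReal ((1 - ‖discAut z w‖ ^ 2) ^ t)) :=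
          lintegral_const_mul' _ _ ENNReal.ofReal_ne_top
      _ ≤ _ := by gcongr; exact lintegral_deriv_discAut_le t f hz
  have h3 := h1.trans h2
  rw [← ENNReal.ofReal_toReal hf.2.ne, ← ofReal_norm, ← ENNReal.ofReal_pow (norm_nonneg _),
    ← ENNReal.ofReal_pow ENNReal.toReal_nonneg, ← ENNReal.ofReal_mul (by positivity),
    ← ENNReal.ofReal_mul (by positivity), ENNReal.ofReal_le_ofReal_iff (by positivity)] at h3
  have hpi := Real.pi_gt_three
  set Q := (qNorm t f).toReal
  have hQ : 0 ≤ Q := ENNReal.toReal_nonneg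
  apply le_of_sq_le_sq _ (by positivity)
  have h4 : 3 * (d / 2) ^ 2 * ‖deriv f z‖ ^ 2 ≤ Real.pi * (d / 2) ^ 2 * ‖deriv f z‖ ^ 2 := by gcongr
  have h5 : K * Q ^ 2 ≤ K ^ 2 * Q ^ 2 := by gcongr; nlinarith
  nlinarith [sq_nonneg (d * ‖deriv f z‖)]

lemma norm_apply_zero_le {t : ℝ} {f : ℂ → ℂ} (hf : f ∈ QSpace t) :
    ‖f 0‖ ≤ (qNorm t f).toReal := by
  rw [← toReal_enorm]
  exact ENNReal.toReal_mono hf.2.ne le_self_add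

/-- Functions in `𝒬_t` grow at most logarithmically. -/
lemma norm_le_log {t : ℝ} (ht : 0 < t) {f : ℂ → ℂ} (hf : f ∈ QSpace t) {r : ℝ} (hr0 : 0 ≤ r)
    (hr1 : r < 1) {ζ : ℂ} (hζ : ‖ζ‖ = 1) :
    ‖f (r * ζ)‖ ≤ (qNorm t f).toReal * (1 + 2 * (25 / 2 : ℝ) ^ t * (-Real.log (1 - r))) := by
  set Q := (qNorm t f).toReal
  set B := 2 * (25 / 2 : ℝ) ^ t
  have hd : ∀ x ∈ Set.Icc 0 r, HasDerivAt (fun x : ℝ => f (x * ζ)) (deriv f (x * ζ) * ζ) x := by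
    intro x hx
    have hm : (x * ζ : ℂ) ∈ disc := by
      rw [mem_disc, norm_mul, hζ, Complex.norm_real, Real.norm_of_nonneg hx.1]; linarith [hx.2]
    have h1 := (hf.1.differentiableAt (Metric.isOpen_ball.mem_nhds hm)).hasDerivAt
    have h2 : HasDerivAt (fun x : ℝ => (x : ℂ) * ζ) ζ x := by
      simpa using (Complex.ofRealCLM.hasDerivAt (x := x)).mul_const ζ
    exact h1.comp x h2
  have hl : ∀ x ∈ Set.Icc 0 r, HasDerivAt (fun x : ℝ => Q * (1 + B * (-Real.log (1 - x))))
      (Q * (B * (1 / (1 - x)))) x := by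
    intro x hx
    have h1 : (1 - x) ≠ 0 := by linarith [hx.2]
    have h2 := (((hasDerivAt_id x).const_sub 1).log h1).neg.const_mul B
    have h3 := (h2.const_add 1).const_mul Q
    rw [neg_div, neg_neg] at h3
    exact h3
  -- Integrate the Bloch estimate along the radius: the comparison function starts at `Q ≥ |f(0)|`
  -- and its derivative is the Bloch bound.
  refine image_norm_le_of_norm_deriv_right_le_deriv_boundary' (f := fun x : ℝ => f (x * ζ))
    (B := fun x : ℝ => Q * (1 + B * (-Real.log (1 - x))))
    (fun x hx => (hd x hx).continuousAt.continuousWithinAt)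
    (fun x hx => (hd x (Set.Ico_subset_Icc_self hx)).hasDerivWithinAt) ?_
    (fun x hx => (hl x hx).continuousAt.continuousWithinAt)
    (fun x hx => (hl x (Set.Ico_subset_Icc_self hx)).hasDerivWithinAt) ?_ ⟨hr0, le_rfl⟩
  · simpa using norm_apply_zero_le hf
  · intro x hx
    have hn : ‖(x * ζ : ℂ)‖ = x := by
      rw [norm_mul, hζ, Complex.norm_real, Real.norm_of_nonneg hx.1, mul_one]
    have h := one_sub_norm_mul_norm_deriv_le ht hf (z := x * ζ) (by rw [hn]; linarith [hx.2])
    rw [hn] at h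
    have h1 : 0 < 1 - x := by linarith [hx.2]
    rw [norm_mul, hζ, mul_one]
    calc ‖deriv f (x * ζ)‖ ≤ (B * Q) / (1 - x) := by rwa [le_div_iff₀ h1, mul_comm]
      _ = _ := by ring

/-! ### Chords, arcs and tents -/

lemma norm_exp_sub_exp (θ φ : ℝ) :
    ‖Complex.exp (θ * Complex.I) - Complex.exp (φ * Complex.I)‖ = ‖2 * Real.sin ((θ - φ) / 2)‖ := by
  rw [← Complex.norm_exp_I_mul_ofReal_sub_one]
  have : Complex.exp (θ * Complex.I) - Complex.exp (φ * Complex.I) =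
      (Complex.exp (Complex.I * (θ - φ : ℝ)) - 1) * Complex.exp (φ * Complex.I) := by
    rw [sub_mul, ← Complex.exp_add, one_mul]
    congr 2; push_cast; ring
  rw [this, norm_mul, Complex.norm_exp_ofReal_mul_I, mul_one]

lemma norm_exp_sub_exp_le (θ φ : ℝ) :
    ‖Complex.exp (θ * Complex.I) - Complex.exp (φ * Complex.I)‖ ≤ |θ - φ| := by
  rw [norm_exp_sub_exp, Real.norm_eq_abs, abs_mul, abs_two]
  have := Real.abs_sin_le_abs (x := (θ - φ) / 2)
  rw [abs_div, abs_two] at this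
  linarith

/-- Jordan's inequality for the half angle, which the hypothesis keeps within `π / 2`. -/
lemma le_norm_exp_sub_exp {θ φ : ℝ} (h : |θ - φ| ≤ Real.pi) :
    2 / Real.pi * |θ - φ| ≤ ‖Complex.exp (θ * Complex.I) - Complex.exp (φ * Complex.I)‖ := by
  rw [norm_exp_sub_exp, Real.norm_eq_abs, abs_mul, abs_two]
  have := Real.mul_abs_le_abs_sin (x := (θ - φ) / 2) (by rw [abs_div, abs_two]; linarith)
  rw [abs_div, abs_two] at this
  linarith

namespace Subarc

variable (I : Subarc)

lemma length_pos : 0 < I.length :=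
  div_pos (sub_pos.2 I.lo_lt_hi) Real.two_pi_pos

lemma length_le_one : I.length ≤ 1 := by
  rw [length, div_le_one Real.two_pi_pos]; linarith [I.hi_le]

lemma hi_sub_lo : I.hi - I.lo = 2 * Real.pi * I.length := by
  rw [length, mul_div_cancel₀ _ Real.two_pi_pos.ne']

/-- The midpoint of an arc. -/
noncomputable def mid : ℂ := Complex.exp (((I.lo + I.hi) / 2 : ℝ) * Complex.I)

/-- The point `(1 - |I|) ζ`, where `ζ` is the midpoint of `I`. -/
noncomputable def apex : ℂ := ((1 - I.length : ℝ) : ℂ) * I.mid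

lemma norm_mid : ‖I.mid‖ = 1 := Complex.norm_exp_ofReal_mul_I _

lemma norm_apex : ‖I.apex‖ = 1 - I.length := by
  rw [apex, norm_mul, norm_mid, mul_one, Complex.norm_real, Real.norm_of_nonneg]
  linarith [I.length_le_one]

lemma norm_apex_lt_one : ‖I.apex‖ < 1 := by
  rw [norm_apex]; linarith [I.length_pos]

lemma norm_of_mem_carrier {ζ : ℂ} (h : ζ ∈ I.carrier) : ‖ζ‖ = 1 := by
  obtain ⟨θ, -, rfl⟩ := I.subset_Icc h
  exact Complex.norm_exp_ofReal_mul_I _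

lemma norm_sub_mid_le {ζ : ℂ} (h : ζ ∈ I.carrier) : ‖I.mid - ζ‖ ≤ 4 * I.length := by
  obtain ⟨θ, hθ, rfl⟩ := I.subset_Icc h
  refine (norm_exp_sub_exp_le _ _).trans ?_
  have h1 := I.hi_sub_lo
  -- The half angle of `I` is `π |I|`, and `π < 4`.
  have : Real.pi * I.length ≤ 4 * I.length := by
    gcongr
    · exact I.length_pos.le
    · exact Real.pi_lt_four.le
  rw [abs_le]
  constructor <;> linarith [hθ.1, hθ.2]

lemma norm_apex_sub_le {ζ : ℂ} (h : ζ ∈ I.carrier) :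
    ‖I.apex - ((1 - I.length : ℝ) : ℂ) * ζ‖ ≤ 4 * I.length := by
  rw [apex, ← mul_sub, norm_mul, Complex.norm_real,
    Real.norm_of_nonneg (by linarith [I.length_le_one])]
  refine (mul_le_of_le_one_left (norm_nonneg _) ?_).trans (I.norm_sub_mid_le h)
  linarith [I.length_pos]

lemma pos_of_mem_tent {z : ℂ} (h : z ∈ I.tent) : 0 < ‖z‖ := by
  linarith [h.1, I.length_le_one]

/-- The carrier differs from the compact closed arc by at most the two endpoints. -/
lemma measurableSet_carrier : MeasurableSet I.carrier := by
  set e : ℝ → ℂ := fun θ : ℝ => Complex.exp (θ * Complex.I)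
  have hK : IsCompact (e '' Set.Icc I.lo I.hi) := isCompact_Icc.image (by fun_prop)
  have hfin : (e '' Set.Icc I.lo I.hi \ I.carrier).Finite := by
    apply Set.Finite.subset (Set.toFinite {e I.lo, e I.hi})
    rintro _ ⟨⟨θ, hθ, rfl⟩, hn⟩
    rcases hθ.1.eq_or_lt with h | h
    · left; rw [h]
    rcases hθ.2.eq_or_lt with h' | h'
    · right; rw [h']; rfl
    · exact absurd (I.Ioo_subset ⟨θ, ⟨h, h'⟩, rfl⟩) hn
  rw [← Set.sdiff_sdiff_cancel_left I.subset_Icc]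
  exact hK.measurableSet.diff hfin.measurableSet

lemma measurableSet_tent : MeasurableSet I.tent := by
  have h1 : MeasurableSet {z : ℂ | 1 - I.length < ‖z‖} :=
    measurableSet_lt measurable_const measurable_norm
  have h2 : MeasurableSet {z : ℂ | ‖z‖ < 1} := measurableSet_lt measurable_norm measurable_const
  have h3 : MeasurableSet {z : ℂ | z / (‖z‖ : ℂ) ∈ I.carrier} :=
    (by fun_prop : Measurable fun z : ℂ => z / (‖z‖ : ℂ)) I.measurableSet_carrier
  exact h1.inter (h2.inter h3)

/-- The closed arc with midpoint `exp (iθ)` and half angle `h`. -/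
def closedArc (θ h : ℝ) (h0 : 0 < h) (hπ : h ≤ Real.pi) : Subarc where
  lo := θ - h
  hi := θ + h
  lo_lt_hi := by linarith
  hi_le := by linarith
  carrier := (fun θ : ℝ => Complex.exp (θ * Complex.I)) '' Set.Icc (θ - h) (θ + h)
  Ioo_subset := Set.image_mono Set.Ioo_subset_Icc_self
  subset_Icc := subset_rfl

end Subarc

/-! ### Whitney chains and the oscillation over a tent -/

/-- The shadow of a Whitney disc lies in a tent of comparable size. -/
lemma measure_shadow_le {s M : ℝ} (hs : 0 ≤ s) (hM : 0 ≤ M) {μ : Measure ℂ}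
    (hμ : ∀ I : Subarc, μ I.tent ≤ ENNReal.ofReal (M * I.length ^ s))
    {δ : ℝ} (hδ : 0 < δ) (w : ℂ) :
    μ {z : ℂ | 0 < ‖z‖ ∧ ‖z‖ < 1 ∧ 1 - δ ≤ ‖z‖ ∧
      ‖w - ((1 - δ : ℝ) : ℂ) * (z / (‖z‖ : ℂ))‖ < 3 * δ / 4} ≤
      ENNReal.ofReal (M * (2 * δ) ^ s) := by
  set E := {z : ℂ | 0 < ‖z‖ ∧ ‖z‖ < 1 ∧ 1 - δ ≤ ‖z‖ ∧
      ‖w - ((1 - δ : ℝ) : ℂ) * (z / (‖z‖ : ℂ))‖ < 3 * δ / 4} with hE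
  have hpi := Real.pi_pos
  rcases E.eq_empty_or_nonempty with h | ⟨z', hz'⟩
  · rw [h]; simp
  -- The arc is centred at the direction of an arbitrary point `z'` of the shadow and has length
  -- `min 1 (2δ)`; the cap at `π` covers large `δ`.
  set h := min Real.pi (2 * Real.pi * δ) with hh
  have h0 : 0 < h := lt_min hpi (by positivity)
  set J := Subarc.closedArc (Complex.arg z') h h0 (min_le_left _ _) with hJ
  have hlen : J.length = h / Real.pi := by
    simp only [Subarc.length, hJ, Subarc.closedArc]; field_simp; ring
  have hlen2 : J.length ≤ 2 * δ := by
    rw [hlen, div_le_iff₀ hpi]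
    refine (min_le_right _ _).trans_eq (by ring)
  have hsub : E ⊆ J.tent := by
    intro z hz
    have hu : ∀ {x : ℂ}, 0 < ‖x‖ → ‖x / (‖x‖ : ℂ)‖ = 1 := by
      intro x hx
      rw [norm_div, Complex.norm_real, norm_norm, div_self hx.ne']
    have hexp : ∀ {x : ℂ}, 0 < ‖x‖ → Complex.exp (x.arg * Complex.I) = x / (‖x‖ : ℂ) := by
      intro x hx
      rw [eq_div_iff (by exact_mod_cast hx.ne'), mul_comm, Complex.norm_mul_exp_arg_mul_I]
    set ζ := z / (‖z‖ : ℂ) with hζ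
    set ζ' := z' / (‖z'‖ : ℂ) with hζ'
    have hζ1 : ‖ζ‖ = 1 := hu hz.1
    have hζ'1 : ‖ζ'‖ = 1 := hu hz'.1
    have hζ'0 : ζ' ≠ 0 := by rw [← norm_pos_iff, hζ'1]; norm_num
    set φ := Complex.arg (ζ / ζ') with hφ
    have hq : ζ = Complex.exp ((z'.arg + φ : ℝ) * Complex.I) := by
      have h1 : ‖ζ / ζ'‖ = 1 := by rw [norm_div, hζ1, hζ'1, div_one]
      have h2 := hexp (x := ζ / ζ') (by rw [h1]; norm_num)
      rw [h1, Complex.ofReal_one, div_one, ← hφ] at h2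
      push_cast
      rw [add_mul, Complex.exp_add, h2, hexp hz'.1, ← hζ', mul_div_cancel₀ _ hζ'0]
    have hφπ : |φ| ≤ Real.pi := Complex.abs_arg_le_pi _
    have hφh : |φ| ≤ h := by
      refine le_min hφπ ?_
      -- For `δ ≥ 1/2` the arc is the full circle. Otherwise two directions in the shadow differ by
      -- at most `(3δ/2) / (1 - δ) ≤ 3δ`, so by the chord estimate their angle is at most `3πδ/2 <
      -- 2πδ`.
      rcases le_or_gt (1 / 2) δ with hd | hd
      · nlinarith
      · have h3 := le_norm_exp_sub_exp (θ := z'.arg + φ) (φ := z'.arg) (by simpa using hφπ)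
        rw [← hq, hexp hz'.1, ← hζ', add_sub_cancel_left] at h3
        have h4 : (1 - δ) * ‖ζ - ζ'‖ ≤ 3 * δ / 2 := by
          have h5 : ‖((1 - δ : ℝ) : ℂ) * (ζ - ζ')‖ = (1 - δ) * ‖ζ - ζ'‖ := by
            rw [norm_mul, Complex.norm_real, Real.norm_of_nonneg (by linarith)]
          rw [← h5]
          have h6 : ((1 - δ : ℝ) : ℂ) * (ζ - ζ') = (w - ((1 - δ : ℝ) : ℂ) * ζ') -
            (w - ((1 - δ : ℝ) : ℂ) * ζ) := by ring
          rw [h6]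
          refine (norm_sub_le _ _).trans ?_
          linarith [hz.2.2.2, hz'.2.2.2]
        have h7 : ‖ζ - ζ'‖ ≤ 3 * δ := by nlinarith [norm_nonneg (ζ - ζ')]
        have h8 := h3.trans h7
        rw [div_mul_eq_mul_div, div_le_iff₀ hpi] at h8
        nlinarith
    rw [abs_le] at hφh
    refine ⟨?_, hz.2.1, z'.arg + φ, ⟨by linarith, by linarith⟩, hq.symm⟩
    rw [hlen]
    rcases min_choice Real.pi (2 * Real.pi * δ) with h9 | h9
    · rw [hh, h9, div_self hpi.ne']; simpa using hz.1
    · rw [hh, h9]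
      have : 2 * Real.pi * δ / Real.pi = 2 * δ := by field_simp
      rw [this]; linarith [hz.2.2.1]
  calc μ E ≤ μ J.tent := measure_mono hsub
    _ ≤ ENNReal.ofReal (M * J.length ^ s) := hμ J
    _ ≤ _ := by
      have := J.length_pos.le
      gcongr

lemma enorm_sq_eq_ofReal (x : ℂ) : ‖x‖ₑ ^ 2 = ENNReal.ofReal (‖x‖ ^ 2) := by
  rw [ENNReal.ofReal_pow (norm_nonneg _), ofReal_norm]

/-- A geometric sum truncated to its terms at most `y` is comparable to `y`. -/
lemma sum_rpow_le_of_le {t : ℝ} (ht : 0 < t) {y : ℝ} (hy : 0 < y) (N : ℕ) :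
    ∀ {L : ℝ}, 0 < L → ∑ k ∈ Finset.range N,
      (if L * (1 / 2) ^ k ≤ y then (L * (1 / 2) ^ k) ^ t else 0) ≤
        y ^ t / (1 - (1 / 2 : ℝ) ^ t) := by
  have hp1 : (1 / 2 : ℝ) ^ t < 1 := Real.rpow_lt_one (by norm_num) (by norm_num) ht
  have hp0 : 0 < (1 / 2 : ℝ) ^ t := by positivity
  have hp : 0 < 1 - (1 / 2 : ℝ) ^ t := by linarith
  induction N with
  | zero => intro L _; simp only [Finset.range_zero, Finset.sum_empty]; positivity
  | succ N ih =>
    intro L hL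
    -- If `L ≤ y`, the full geometric series started at `L` is small enough. Otherwise the first
    -- term vanishes and the rest is the same sum started at `L / 2`, which is why the induction
    -- keeps `L` general.
    by_cases h : L ≤ y
    · calc ∑ k ∈ Finset.range (N + 1),
          (if L * (1 / 2) ^ k ≤ y then (L * (1 / 2) ^ k) ^ t else 0)
          ≤ ∑ k ∈ Finset.range (N + 1), L ^ t * ((1 / 2 : ℝ) ^ t) ^ k := by
            apply Finset.sum_le_sum
            intro k _
            have h1 : (L * (1 / 2) ^ k) ^ t = L ^ t * ((1 / 2 : ℝ) ^ t) ^ k := by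
              rw [Real.mul_rpow hL.le (by positivity), ← Real.rpow_natCast, ← Real.rpow_natCast,
                ← Real.rpow_mul (by norm_num), ← Real.rpow_mul (by norm_num), mul_comm t]
            split_ifs
            · exact h1.le
            · positivity
        _ = L ^ t * ∑ k ∈ Finset.range (N + 1), ((1 / 2 : ℝ) ^ t) ^ k := by rw [Finset.mul_sum]
        _ ≤ L ^ t * (1 - (1 / 2 : ℝ) ^ t)⁻¹ := by
            gcongr
            rw [← tsum_geometric_of_lt_one hp0.le hp1]
            exact (summable_geometric_of_lt_one hp0.le hp1).sum_le_tsum _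
              (fun _ _ => by positivity)
        _ ≤ y ^ t / (1 - (1 / 2 : ℝ) ^ t) := by rw [← div_eq_mul_inv]; gcongr
    · rw [Finset.sum_range_succ']
      simp only [pow_zero, mul_one, h, if_false, add_zero]
      refine le_of_eq_of_le (Finset.sum_congr rfl fun k _ => ?_) (ih (half_pos hL))
      rw [pow_succ, show L * ((1 / 2) ^ k * (1 / 2)) = L / 2 * (1 / 2) ^ k by ring]

/-- The oscillation of a holomorphic function along a radius is controlled by its Dirichlet
integrals over Whitney discs along the radius. -/
lemma enorm_sub_radial_sq_le {f : ℂ → ℂ} (hf : DifferentiableOn ℂ f disc) {ζ : ℂ} (hζ : ‖ζ‖ = 1)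
    {L r q : ℝ} (hL0 : 0 < L) (hL1 : L ≤ 1) (hr : 1 - L ≤ r) (hr1 : r < 1) (hq0 : 0 < q)
    (hq1 : q < 1) :
    ‖f (r * ζ) - f (((1 - L : ℝ) : ℂ) * ζ)‖ₑ ^ 2 ≤
      ENNReal.ofReal (1 - q)⁻¹ * ∑' k : ℕ, ENNReal.ofReal (q⁻¹ ^ k) *
        (if 1 - L * (1 / 2) ^ k ≤ r then
          2 * ∫⁻ w in Metric.ball (((1 - L * (1 / 2) ^ k : ℝ) : ℂ) * ζ) (3 * (L * (1 / 2) ^ k) / 4),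
            ‖deriv f w‖ₑ ^ 2 else 0) := by
  set δ : ℕ → ℝ := fun k => L * (1 / 2) ^ k with hδ
  have hδ0 : ∀ k, 0 < δ k := fun k => by positivity
  have hδL : ∀ k, δ k ≤ L := fun k =>
    mul_le_of_le_one_right hL0.le (pow_le_one₀ (by norm_num) (by norm_num))
  have hδs : ∀ k, δ (k + 1) = δ k / 2 := fun k => by simp only [hδ, pow_succ]; ring
  -- Stopping the chain at `r` makes it eventually constant, so the telescoping sum is finite and
  -- every step with `1 - δ k > r` is zero.
  set x : ℕ → ℝ := fun k => min (1 - δ k) r with hx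
  set u : ℕ → ℝ := fun k => ‖f (x (k + 1) * ζ) - f (x k * ζ)‖ with hu
  have hu2 : ∀ k, ENNReal.ofReal (u k ^ 2) ≤ if 1 - δ k ≤ r then
      2 * ∫⁻ w in Metric.ball (((1 - δ k : ℝ) : ℂ) * ζ) (3 * δ k / 4),
        ‖deriv f w‖ₑ ^ 2 else 0 := by
    intro k
    have h1 := hδs k
    have h2 := hδ0 k
    split_ifs with h
    · have hxk : x k = 1 - δ k := min_eq_left h
      rw [hu, ← enorm_sq_eq_ofReal, hxk]
      apply enorm_sub_sq_le_lintegral_deriv h2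
      · apply hf.mono
        intro p hp
        rw [Metric.mem_ball, dist_eq_norm] at hp
        rw [mem_disc]
        have := norm_le_norm_add_norm_sub' p (((1 - δ k : ℝ) : ℂ) * ζ)
        rw [norm_mul, hζ, Complex.norm_real, mul_one,
          Real.norm_of_nonneg (by linarith [hδL k])] at this
        linarith
      · rw [← sub_mul, ← Complex.ofReal_sub, norm_mul, hζ, mul_one, Complex.norm_real,
          Real.norm_eq_abs, abs_le]
        have h3 : x (k + 1) ≤ 1 - δ (k + 1) := min_le_left _ _
        have h4 : 1 - δ k ≤ x (k + 1) := le_min (by linarith) h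
        constructor <;> linarith
    · push Not at h
      have hxk : x k = r := min_eq_right h.le
      have hxk' : x (k + 1) = r := min_eq_right (by linarith)
      simp [hu, hxk, hxk']
  obtain ⟨N, hN⟩ : ∃ N, δ N < 1 - r := by
    obtain ⟨N, hN⟩ := exists_pow_lt_of_lt_one (sub_pos.2 hr1) (by norm_num : (1 / 2 : ℝ) < 1)
    exact ⟨N, (mul_le_of_le_one_left (by positivity) hL1).trans_lt hN⟩
  have hxN : x N = r := min_eq_right (by linarith)
  have hx0 : x 0 = 1 - L := by simp only [hx, hδ, pow_zero, mul_one]; exact min_eq_left hr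
  have h1 : ‖f (r * ζ) - f (((1 - L : ℝ) : ℂ) * ζ)‖ ≤ ∑ k ∈ Finset.range N, u k := by
    rw [← hxN, ← hx0, ← Finset.sum_range_sub (fun k => f (x k * ζ))]
    exact norm_sum_le _ _
  -- Cauchy-Schwarz after writing `u k = q^{k/2} · q^{-k/2} u k`.
  have h2 : (∑ k ∈ Finset.range N, u k) ^ 2 ≤
      (∑ k ∈ Finset.range N, q ^ k) * ∑ k ∈ Finset.range N, q⁻¹ ^ k * u k ^ 2 := by
    apply Finset.sum_sq_le_sum_mul_sum_of_sq_le_mul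
    · intros; positivity
    · intros; positivity
    · intro k _
      rw [← mul_assoc, ← mul_pow, mul_inv_cancel₀ hq0.ne', one_pow, one_mul]
  have h3 : ∑ k ∈ Finset.range N, q ^ k ≤ (1 - q)⁻¹ := by
    rw [← tsum_geometric_of_lt_one hq0.le hq1]
    exact (summable_geometric_of_lt_one hq0.le hq1).sum_le_tsum _ (fun _ _ => by positivity)
  have hq : 0 ≤ (1 - q)⁻¹ := inv_nonneg.2 (by linarith)
  have h4 : ‖f (r * ζ) - f (((1 - L : ℝ) : ℂ) * ζ)‖ ^ 2 ≤
      (1 - q)⁻¹ * ∑ k ∈ Finset.range N, q⁻¹ ^ k * u k ^ 2 := by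
    calc _ ≤ (∑ k ∈ Finset.range N, u k) ^ 2 := by gcongr
      _ ≤ _ := h2
      _ ≤ _ := by gcongr
  rw [enorm_sq_eq_ofReal]
  refine (ENNReal.ofReal_le_ofReal h4).trans ?_
  rw [ENNReal.ofReal_mul hq, ENNReal.ofReal_sum_of_nonneg (fun k _ => by positivity)]
  gcongr
  refine le_trans (Finset.sum_le_sum fun k _ => ?_) (ENNReal.sum_le_tsum (Finset.range N))
  rw [ENNReal.ofReal_mul (by positivity)]
  gcongr
  exact hu2 k

/-- The oscillation of a `𝒬_t` function over a tent, with respect to an `s`-Carleson measure. -/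
lemma lintegral_tent_oscillation_le {s t M : ℝ} (ht : 0 < t) (hts : t < s) (hM : 0 ≤ M)
    {μ : Measure ℂ} (hμ : ∀ I : Subarc, μ I.tent ≤ ENNReal.ofReal (M * I.length ^ s))
    {f : ℂ → ℂ} (hf : f ∈ QSpace t) (I : Subarc) :
    ∫⁻ z in I.tent, ‖f z - f (((1 - I.length : ℝ) : ℂ) * (z / (‖z‖ : ℂ)))‖ₑ ^ 2 ∂μ ≤
      ENNReal.ofReal ((1 - (1 / 2 : ℝ) ^ (s - t))⁻¹ * (2 * M * 2 ^ s * 4 ^ t * 49 ^ t /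
        (1 - (1 / 2 : ℝ) ^ t)) * I.length ^ s) * qNorm t f ^ 2 := by
  set L := I.length with hL
  have hL0 : 0 < L := I.length_pos
  have hL1 : L ≤ 1 := I.length_le_one
  -- This ratio is chosen so that `q^{-k} δ_k^s` becomes `L^{s-t} δ_k^t`, the exponent of the `𝒬_t`
  -- weight.
  set q : ℝ := (1 / 2 : ℝ) ^ (s - t) with hq
  have hq0 : 0 < q := by positivity
  have hq1 : q < 1 := Real.rpow_lt_one (by norm_num) (by norm_num) (by linarith)
  have hp1 : (1 / 2 : ℝ) ^ t < 1 := Real.rpow_lt_one (by norm_num) (by norm_num) ht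
  have hs0 : 0 ≤ s := by linarith
  have hp : 0 < 1 - (1 / 2 : ℝ) ^ t := by linarith
  have hq' : 0 ≤ (1 - q)⁻¹ := inv_nonneg.2 (by linarith)
  set δ : ℕ → ℝ := fun k => L * (1 / 2) ^ k with hδ
  have hδ0 : ∀ k, 0 < δ k := fun k => by positivity
  have hδL : ∀ k, δ k ≤ L := fun k =>
    mul_le_of_le_one_right hL0.le (pow_le_one₀ (by norm_num) (by norm_num))
  set ν := μ.restrict I.tent with hν
  -- Tonelli is applied below to the restriction of `μ` to the tent; the Carleson bound makes it
  -- finite, although `μ` is arbitrary.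
  have : IsFiniteMeasure ν := by
    constructor
    rw [hν, Measure.restrict_apply_univ]
    exact (hμ I).trans_lt ENNReal.ofReal_lt_top
  set P : ℕ → Set (ℂ × ℂ) := fun k => {p | 1 - δ k ≤ ‖p.1‖ ∧
    ‖p.2 - ((1 - δ k : ℝ) : ℂ) * (p.1 / (‖p.1‖ : ℂ))‖ < 3 * δ k / 4} with hP
  have hPm : ∀ k, MeasurableSet (P k) := fun k =>
    (measurableSet_le (g := fun p : ℂ × ℂ => ‖p.1‖) measurable_const (by fun_prop)).inter
      (measurableSet_lt (f := fun p : ℂ × ℂ =>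
        ‖p.2 - ((1 - δ k : ℝ) : ℂ) * (p.1 / (‖p.1‖ : ℂ))‖) (by fun_prop) measurable_const)
  set D : ℂ → ℝ≥0∞ := fun w => ‖deriv f w‖ₑ ^ 2 with hD
  have hDm : Measurable D := (measurable_deriv f).enorm.pow_const 2
  set S : ℕ → ℂ × ℂ → ℝ≥0∞ := fun k => (P k).indicator fun p => D p.2 with hS
  have hSm : ∀ k, Measurable (S k) := fun k => (hDm.comp measurable_snd).indicator (hPm k)
  -- The region holding every `w` seen at scale `k`. Such a `w` lies within `3δ_k/4` of a point of
  -- modulus `1 - δ_k`, so `1 - |w| ≥ δ_k/4`. The constant `7` is `2 + 4 + 1`: `2L` from `1 - |a|`,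
  -- `4L` from the angular spread, and at most `L` from the radial shift plus the Whitney radius.
  set E : ℕ → Set ℂ := fun k => {w | ‖w‖ < 1 ∧ δ k ≤ 4 * (1 - ‖w‖) ∧
    ‖1 - (starRingEnd ℂ) I.apex * w‖ ≤ 7 * L} with hE
  have hEm : ∀ k, MeasurableSet (E k) := fun k =>
    (measurableSet_lt measurable_norm measurable_const).inter
      ((measurableSet_le (g := fun w : ℂ => 4 * (1 - ‖w‖)) measurable_const (by fun_prop)).inter
      (measurableSet_le (f := fun w => ‖1 - (starRingEnd ℂ) I.apex * w‖) (by fun_prop)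
        measurable_const))
  have hchain : ∀ z ∈ I.tent, ‖f z - f (((1 - L : ℝ) : ℂ) * (z / (‖z‖ : ℂ)))‖ₑ ^ 2 ≤
      ENNReal.ofReal (1 - q)⁻¹ * ∑' k : ℕ, ENNReal.ofReal (2 * q⁻¹ ^ k) * ∫⁻ w, S k (z, w) := by
    intro z hz
    have hz0 := I.pos_of_mem_tent hz
    have h1 := enorm_sub_radial_sq_le hf.1 (I.norm_of_mem_carrier hz.2.2) hL0 hL1 hz.1.le hz.2.1
      hq0 hq1
    rw [mul_div_cancel₀ _ (by exact_mod_cast hz0.ne' : (‖z‖ : ℂ) ≠ 0)] at h1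
    refine h1.trans_eq ?_
    congr 1
    refine tsum_congr fun k => ?_
    rw [mul_comm 2 (q⁻¹ ^ k), ENNReal.ofReal_mul (by positivity), mul_assoc]
    congr 1
    have h2 : ∀ w, S k (z, w) = if 1 - δ k ≤ ‖z‖ then
        (Metric.ball (((1 - δ k : ℝ) : ℂ) * (z / (‖z‖ : ℂ))) (3 * δ k / 4)).indicator D w
        else 0 := by
      intro w
      by_cases h3 : 1 - δ k ≤ ‖z‖
      · rw [if_pos h3]
        by_cases h4 : ‖w - ((1 - δ k : ℝ) : ℂ) * (z / (‖z‖ : ℂ))‖ < 3 * δ k / 4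
        · rw [Set.indicator_of_mem (by rwa [Metric.mem_ball, dist_eq_norm])]
          exact Set.indicator_of_mem (show (z, w) ∈ P k from ⟨h3, h4⟩) _
        · rw [Set.indicator_of_notMem (by rwa [Metric.mem_ball, dist_eq_norm])]
          exact Set.indicator_of_notMem (fun h : (z, w) ∈ P k => h4 h.2) _
      · rw [if_neg h3]
        exact Set.indicator_of_notMem (fun h : (z, w) ∈ P k => h3 h.1) _
    simp_rw [h2]
    split_ifs with h3
    · rw [lintegral_indicator measurableSet_ball]; simp [hD, hδ]
    · simp
  have hshadow : ∀ k w, ∫⁻ z, S k (z, w) ∂ν ≤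
      ENNReal.ofReal (M * (2 * δ k) ^ s) * (E k).indicator D w := by
    intro k w
    have hT : MeasurableSet {z | (z, w) ∈ P k} := (by fun_prop : Measurable fun z : ℂ => (z, w)) (hPm k)
    have h1 : ∫⁻ z, S k (z, w) ∂ν = D w * ν {z | (z, w) ∈ P k} := by
      rw [← lintegral_indicator_const hT]
      refine lintegral_congr fun z => ?_
      simp only [hS, Set.indicator_apply, Set.mem_ofPred_eq]
    rw [h1, hν, Measure.restrict_apply hT]
    rcases ({z | (z, w) ∈ P k} ∩ I.tent).eq_empty_or_nonempty with h | ⟨z, hz, hzI⟩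
    · rw [h]; simp
    have hwE : w ∈ E k := by
      have hζ := I.norm_of_mem_carrier hzI.2.2
      have hd := hδ0 k
      have hdL := hδL k
      have hz2 := hz.2
      simp only at hz2
      have hn : ‖((1 - δ k : ℝ) : ℂ) * (z / (‖z‖ : ℂ))‖ = 1 - δ k := by
        rw [norm_mul, hζ, mul_one, Complex.norm_real, Real.norm_of_nonneg (by linarith)]
      have h2 := norm_le_norm_add_norm_sub' w (((1 - δ k : ℝ) : ℂ) * (z / (‖z‖ : ℂ)))
      rw [hn] at h2
      refine ⟨by linarith, by linarith, ?_⟩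
      have h3 := norm_one_sub_conj_mul_le (a := I.apex) (w := w) I.norm_apex_lt_one.le
      have h4 := I.norm_apex_sub_le hzI.2.2
      have h5 : ‖((1 - I.length : ℝ) : ℂ) * (z / (‖z‖ : ℂ)) -
          ((1 - δ k : ℝ) : ℂ) * (z / (‖z‖ : ℂ))‖ = L - δ k := by
        rw [← sub_mul, ← Complex.ofReal_sub, norm_mul, hζ, mul_one, Complex.norm_real, ← hL,
          Real.norm_eq_abs, abs_of_nonpos (by linarith)]
        ring
      have h6 : I.apex - w = (I.apex - ((1 - I.length : ℝ) : ℂ) * (z / (‖z‖ : ℂ))) +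
          (((1 - I.length : ℝ) : ℂ) * (z / (‖z‖ : ℂ)) - ((1 - δ k : ℝ) : ℂ) * (z / (‖z‖ : ℂ))) -
          (w - ((1 - δ k : ℝ) : ℂ) * (z / (‖z‖ : ℂ))) := by ring
      have h7 := norm_sub_le (I.apex - ((1 - I.length : ℝ) : ℂ) * (z / (‖z‖ : ℂ)) +
          (((1 - I.length : ℝ) : ℂ) * (z / (‖z‖ : ℂ)) - ((1 - δ k : ℝ) : ℂ) * (z / (‖z‖ : ℂ))))
          (w - ((1 - δ k : ℝ) : ℂ) * (z / (‖z‖ : ℂ)))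
      have h8 := norm_add_le (I.apex - ((1 - I.length : ℝ) : ℂ) * (z / (‖z‖ : ℂ)))
          (((1 - I.length : ℝ) : ℂ) * (z / (‖z‖ : ℂ)) - ((1 - δ k : ℝ) : ℂ) * (z / (‖z‖ : ℂ)))
      rw [← h6] at h7
      rw [I.norm_apex, ← hL] at h3
      rw [h5] at h8
      linarith
    rw [Set.indicator_of_mem hwE, mul_comm]
    gcongr
    refine (measure_mono ?_).trans (measure_shadow_le hs0 hM hμ (hδ0 k) w)
    rintro z ⟨hz, hzI⟩
    exact ⟨I.pos_of_mem_tent hzI, hzI.2.1, hz.1, hz.2⟩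
  have hsum : ∀ w, ∑' k, ENNReal.ofReal (2 * q⁻¹ ^ k) *
      (ENNReal.ofReal (M * (2 * δ k) ^ s) * (E k).indicator D w) ≤
      disc.indicator (fun w => ENNReal.ofReal
        (2 * M * 2 ^ s * 4 ^ t * 49 ^ t / (1 - (1 / 2 : ℝ) ^ t) * L ^ s) *
        (D w * ENNReal.ofReal ((1 - ‖discAut I.apex w‖ ^ 2) ^ t))) w := by
    intro w
    by_cases hw : ‖w‖ < 1 ∧ ‖1 - (starRingEnd ℂ) I.apex * w‖ ≤ 7 * L
    swap
    · have : ∀ k, w ∉ E k := fun k hk => hw ⟨hk.1, hk.2.2⟩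
      simp [this]
    obtain ⟨hw1, hwL⟩ := hw
    have hw0 : 0 < 1 - ‖w‖ := by linarith
    rw [Set.indicator_of_mem (mem_disc.2 hw1)]
    have hterm : ∀ k, ENNReal.ofReal (2 * q⁻¹ ^ k) *
        (ENNReal.ofReal (M * (2 * δ k) ^ s) * (E k).indicator D w) =
        ENNReal.ofReal (2 * M * 2 ^ s * L ^ (s - t) *
          (if L * (1 / 2) ^ k ≤ 4 * (1 - ‖w‖) then (L * (1 / 2) ^ k) ^ t else 0)) * D w := by
      intro k
      by_cases h : δ k ≤ 4 * (1 - ‖w‖)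
      · rw [Set.indicator_of_mem (show w ∈ E k from ⟨hw1, h, hwL⟩), if_pos h, ← mul_assoc,
          ← ENNReal.ofReal_mul (by positivity)]
        congr 2
        have h1 : q⁻¹ ^ k * (δ k) ^ s = L ^ (s - t) * (δ k) ^ t := by
          have h2 : δ k ^ s = δ k ^ (s - t) * δ k ^ t := by
            rw [← Real.rpow_add (hδ0 k)]; congr 1; ring
          have h3 : δ k ^ (s - t) = L ^ (s - t) * q ^ k := by
            rw [hδ, Real.mul_rpow hL0.le (by positivity), hq, ← Real.rpow_natCast,
              ← Real.rpow_natCast, ← Real.rpow_mul (by norm_num), ← Real.rpow_mul (by norm_num),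
              mul_comm (k : ℝ)]
          rw [h2, h3, inv_pow]
          field_simp
        rw [Real.mul_rpow (by norm_num) (hδ0 k).le]
        calc 2 * q⁻¹ ^ k * (M * (2 ^ s * δ k ^ s)) = 2 * M * 2 ^ s * (q⁻¹ ^ k * δ k ^ s) := by ring
          _ = _ := by rw [h1]; ring
      · have : w ∉ E k := fun hk => h hk.2.1
        rw [Set.indicator_of_notMem this, if_neg h]
        simp
    simp_rw [hterm]
    rw [ENNReal.tsum_mul_right, mul_comm (D w), ← mul_assoc, ← ENNReal.ofReal_mul (by positivity)]
    gcongr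
    apply ENNReal.tsum_le_of_sum_range_le
    intro N
    rw [← ENNReal.ofReal_sum_of_nonneg (fun k _ => by split_ifs <;> positivity), ← Finset.mul_sum]
    apply ENNReal.ofReal_le_ofReal
    have h1 := sum_rpow_le_of_le ht (by positivity : 0 < 4 * (1 - ‖w‖)) N hL0
    -- At the apex `1 - |a| = L`, so `1 - |w|` is traded for `49 L` times the Möbius weight.
    have h2 := one_sub_norm_le_mul_one_sub_discAut (K := 7) I.norm_apex_lt_one hw1
      (by rw [I.norm_apex, ← hL]; linarith)
    rw [I.norm_apex, ← hL] at h2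
    have hφ := one_sub_norm_discAut_sq_nonneg I.norm_apex_lt_one hw1
    have h3 : (1 - ‖w‖) ^ t ≤ 49 ^ t * L ^ t * (1 - ‖discAut I.apex w‖ ^ 2) ^ t := by
      rw [← Real.mul_rpow (by norm_num) hL0.le, ← Real.mul_rpow (by positivity) hφ]
      apply Real.rpow_le_rpow hw0.le _ ht.le
      convert h2 using 2; ring
    have h4 : L ^ s = L ^ (s - t) * L ^ t := by
      rw [← Real.rpow_add hL0]; congr 1; ring
    calc 2 * M * 2 ^ s * L ^ (s - t) * ∑ k ∈ Finset.range N,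
          (if L * (1 / 2) ^ k ≤ 4 * (1 - ‖w‖) then (L * (1 / 2) ^ k) ^ t else 0)
        ≤ 2 * M * 2 ^ s * L ^ (s - t) * ((4 * (1 - ‖w‖)) ^ t / (1 - (1 / 2 : ℝ) ^ t)) := by gcongr
      _ = 2 * M * 2 ^ s * L ^ (s - t) * (4 ^ t * (1 - ‖w‖) ^ t / (1 - (1 / 2 : ℝ) ^ t)) := by
          rw [Real.mul_rpow (by norm_num) hw0.le]
      _ ≤ 2 * M * 2 ^ s * L ^ (s - t) * (4 ^ t * (49 ^ t * L ^ t *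
            (1 - ‖discAut I.apex w‖ ^ 2) ^ t) / (1 - (1 / 2 : ℝ) ^ t)) := by gcongr
      _ = _ := by rw [h4]; ring
  calc ∫⁻ z in I.tent, ‖f z - f (((1 - L : ℝ) : ℂ) * (z / (‖z‖ : ℂ)))‖ₑ ^ 2 ∂μ
      ≤ ∫⁻ z, ENNReal.ofReal (1 - q)⁻¹ * (∑' k : ℕ, ENNReal.ofReal (2 * q⁻¹ ^ k) *
          ∫⁻ w, S k (z, w)) ∂ν := setLIntegral_mono' I.measurableSet_tent hchain
    _ = ENNReal.ofReal (1 - q)⁻¹ * ∑' k : ℕ, ENNReal.ofReal (2 * q⁻¹ ^ k) *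
          ∫⁻ w, ∫⁻ z, S k (z, w) ∂ν := by
        rw [lintegral_const_mul' _ _ ENNReal.ofReal_ne_top, lintegral_tsum]
        · congr 1
          refine tsum_congr fun k => ?_
          rw [lintegral_const_mul' _ _ ENNReal.ofReal_ne_top]
          congr 1
          exact lintegral_lintegral_swap (f := fun z w => S k (z, w)) (hSm k).aemeasurable
        · intro k
          exact ((hSm k).lintegral_prod_right' (ν := volume)).const_mul _ |>.aemeasurable
    _ ≤ ENNReal.ofReal (1 - q)⁻¹ * ∑' k : ℕ, ENNReal.ofReal (2 * q⁻¹ ^ k) *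
          ∫⁻ w, ENNReal.ofReal (M * (2 * δ k) ^ s) * (E k).indicator D w := by
        gcongr with k w
        exact hshadow k w
    _ = ENNReal.ofReal (1 - q)⁻¹ * ∫⁻ w, ∑' k : ℕ, ENNReal.ofReal (2 * q⁻¹ ^ k) *
          (ENNReal.ofReal (M * (2 * δ k) ^ s) * (E k).indicator D w) := by
        rw [lintegral_tsum]
        · congr 1
          exact tsum_congr fun k => (lintegral_const_mul' _ _ ENNReal.ofReal_ne_top).symm
        · intro k
          exact (((hDm.indicator (hEm k)).const_mul _).const_mul _).aemeasurable
    _ ≤ ENNReal.ofReal (1 - q)⁻¹ * ∫⁻ w, disc.indicator (fun w => ENNReal.ofReal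
          (2 * M * 2 ^ s * 4 ^ t * 49 ^ t / (1 - (1 / 2 : ℝ) ^ t) * L ^ s) *
          (D w * ENNReal.ofReal ((1 - ‖discAut I.apex w‖ ^ 2) ^ t))) w := by
        gcongr with w
        exact hsum w
    _ = ENNReal.ofReal (1 - q)⁻¹ * (ENNReal.ofReal
          (2 * M * 2 ^ s * 4 ^ t * 49 ^ t / (1 - (1 / 2 : ℝ) ^ t) * L ^ s) *
          ∫⁻ w in disc, D w * ENNReal.ofReal ((1 - ‖discAut I.apex w‖ ^ 2) ^ t)) := by
        rw [lintegral_indicator (show MeasurableSet disc from measurableSet_ball),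
          lintegral_const_mul' _ _ ENNReal.ofReal_ne_top]
    _ ≤ ENNReal.ofReal (1 - q)⁻¹ * (ENNReal.ofReal
          (2 * M * 2 ^ s * 4 ^ t * 49 ^ t / (1 - (1 / 2 : ℝ) ^ t) * L ^ s) * qNorm t f ^ 2) := by
        gcongr
        exact lintegral_deriv_discAut_le t f I.norm_apex_lt_one
    _ = _ := by rw [← mul_assoc, ← ENNReal.ofReal_mul hq', ← mul_assoc]

/-! ### Carleson measures give a bounded embedding -/

lemma IsCarlesonMeasure.exists_measure_tent_le {s : ℝ} {μ : Measure ℂ}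
    (h : IsCarlesonMeasure s μ) :
    ∃ M : ℝ, 0 ≤ M ∧ ∀ I : Subarc, μ I.tent ≤ ENNReal.ofReal (M * I.length ^ s) := by
  refine ⟨(⨆ I : Subarc, μ I.tent / ENNReal.ofReal (I.length ^ s)).toReal,
    ENNReal.toReal_nonneg, fun I => ?_⟩
  have hL := Real.rpow_pos_of_pos I.length_pos s
  rw [ENNReal.ofReal_mul ENNReal.toReal_nonneg, ENNReal.ofReal_toReal h.ne,
    ← ENNReal.div_le_iff (by simpa using hL) ENNReal.ofReal_ne_top]
  exact le_iSup (fun I : Subarc => μ I.tent / ENNReal.ofReal (I.length ^ s)) I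

lemma enorm_sq_le_two_mul_add (x y : ℂ) : ‖x‖ₑ ^ 2 ≤ 2 * ‖x - y‖ₑ ^ 2 + 2 * ‖y‖ₑ ^ 2 := by
  simp only [enorm_sq_eq_ofReal]
  rw [← ENNReal.ofReal_ofNat, ← ENNReal.ofReal_mul (by norm_num), ← ENNReal.ofReal_mul (by norm_num),
    ← ENNReal.ofReal_add (by positivity) (by positivity)]
  apply ENNReal.ofReal_le_ofReal
  have h := norm_le_norm_sub_add x y
  calc ‖x‖ ^ 2 ≤ (‖x - y‖ + ‖y‖) ^ 2 := by gcongr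
    _ ≤ _ := by nlinarith [sq_nonneg (‖x - y‖ - ‖y‖)]

lemma log_two_le_log (I : Subarc) : Real.log 2 ≤ Real.log (2 / I.length) := by
  apply Real.log_le_log (by norm_num)
  rw [le_div_iff₀ I.length_pos]
  linarith [I.length_le_one]

lemma one_le_two_mul_log (I : Subarc) : 1 ≤ 2 * Real.log (2 / I.length) := by
  linarith [log_two_le_log I, Real.log_two_gt_d9]

/-- Split `f` into its oscillation and its value at the projected point of modulus `1 - |I|`. The
first part is bounded without a logarithm; the second contributes the squared logarithm times the
measure of the tent. -/
lemma exists_lintegral_tent_le {s t M : ℝ} (ht : 0 < t) (hts : t < s) (hM : 0 ≤ M)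
    {μ : Measure ℂ} (hμ : ∀ I : Subarc, μ I.tent ≤ ENNReal.ofReal (M * I.length ^ s)) :
    ∃ D : ℝ, 0 ≤ D ∧ ∀ f ∈ QSpace t, ∀ I : Subarc, ∫⁻ z in I.tent, ‖f z‖ₑ ^ 2 ∂μ ≤
      ENNReal.ofReal (D * (I.length ^ s * Real.log (2 / I.length) ^ 2)) * qNorm t f ^ 2 := by
  have hp1 : (1 / 2 : ℝ) ^ t < 1 := Real.rpow_lt_one (by norm_num) (by norm_num) ht
  have hq1 : (1 / 2 : ℝ) ^ (s - t) < 1 :=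
    Real.rpow_lt_one (by norm_num) (by norm_num) (by linarith)
  have hp : 0 < 1 - (1 / 2 : ℝ) ^ t := by linarith
  have hq : 0 < 1 - (1 / 2 : ℝ) ^ (s - t) := by linarith
  set K : ℝ := (1 - (1 / 2 : ℝ) ^ (s - t))⁻¹ * (2 * M * 2 ^ s * 4 ^ t * 49 ^ t /
        (1 - (1 / 2 : ℝ) ^ t)) with hK
  have hK0 : 0 ≤ K := by positivity
  set B : ℝ := 2 * (25 / 2 : ℝ) ^ t with hB
  have hB0 : 0 ≤ B := by positivity
  refine ⟨8 * K + 2 * (2 + B) ^ 2 * M, by positivity, fun f hf I => ?_⟩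
  have hL0 := I.length_pos
  have hL1 := I.length_le_one
  have hlog := one_le_two_mul_log I
  set l := Real.log (2 / I.length) with hl
  have hl0 : 0 < l := by linarith
  set Q := qNorm t f with hQ
  have hQt : Q ≠ ∞ := hf.2.ne
  have hcent : ∀ z ∈ I.tent, ‖f (((1 - I.length : ℝ) : ℂ) * (z / (‖z‖ : ℂ)))‖ₑ ^ 2 ≤
      ENNReal.ofReal ((2 + B) ^ 2 * l ^ 2) * Q ^ 2 := by
    intro z hz
    have h := norm_le_log ht hf (by linarith : 0 ≤ 1 - I.length) (by linarith)
      (I.norm_of_mem_carrier hz.2.2)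
    rw [sub_sub_cancel] at h
    have h1 : l = Real.log 2 - Real.log I.length := Real.log_div (by norm_num) hL0.ne'
    have h2 : 1 + B * (-Real.log I.length) ≤ (2 + B) * l := by
      have : 0 ≤ Real.log 2 := Real.log_nonneg (by norm_num)
      have : B * (-Real.log I.length) ≤ B * l := by gcongr; linarith
      linarith
    have h3 : ‖f (((1 - I.length : ℝ) : ℂ) * (z / (‖z‖ : ℂ)))‖ ^ 2 ≤
        (2 + B) ^ 2 * l ^ 2 * Q.toReal ^ 2 := by
      calc _ ≤ (Q.toReal * ((2 + B) * l)) ^ 2 := by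
            gcongr
            exact h.trans (by gcongr)
        _ = _ := by ring
    rw [enorm_sq_eq_ofReal, ← ENNReal.ofReal_toReal hQt, ← ENNReal.ofReal_pow ENNReal.toReal_nonneg,
      ← ENNReal.ofReal_mul (by positivity)]
    exact ENNReal.ofReal_le_ofReal h3
  calc ∫⁻ z in I.tent, ‖f z‖ₑ ^ 2 ∂μ
      ≤ ∫⁻ z in I.tent, (2 * ‖f z - f (((1 - I.length : ℝ) : ℂ) * (z / (‖z‖ : ℂ)))‖ₑ ^ 2 +
          2 * (ENNReal.ofReal ((2 + B) ^ 2 * l ^ 2) * Q ^ 2)) ∂μ := by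
        apply setLIntegral_mono' I.measurableSet_tent
        intro z hz
        refine (enorm_sq_le_two_mul_add _
          (f (((1 - I.length : ℝ) : ℂ) * (z / (‖z‖ : ℂ))))).trans ?_
        gcongr
        exact hcent z hz
    _ = 2 * ∫⁻ z in I.tent, ‖f z - f (((1 - I.length : ℝ) : ℂ) * (z / (‖z‖ : ℂ)))‖ₑ ^ 2 ∂μ +
          2 * (ENNReal.ofReal ((2 + B) ^ 2 * l ^ 2) * Q ^ 2) * μ I.tent := by
        rw [lintegral_add_right _ measurable_const, lintegral_const_mul' _ _ (by norm_num),
          setLIntegral_const]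
    _ ≤ 2 * (ENNReal.ofReal (K * I.length ^ s) * Q ^ 2) +
          2 * (ENNReal.ofReal ((2 + B) ^ 2 * l ^ 2) * Q ^ 2) *
            ENNReal.ofReal (M * I.length ^ s) := by
        gcongr
        · exact lintegral_tent_oscillation_le ht hts hM hμ hf I
        · exact hμ I
    _ = ENNReal.ofReal (2 * (K * I.length ^ s) +
          2 * ((2 + B) ^ 2 * l ^ 2) * (M * I.length ^ s)) * Q ^ 2 := by
        have key : ∀ x y z : ℝ, 0 ≤ x → 0 ≤ y → 0 ≤ z → ENNReal.ofReal (2 * x + 2 * y * z) =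
            2 * ENNReal.ofReal x + 2 * ENNReal.ofReal y * ENNReal.ofReal z := by
          intro x y z hx hy hz
          rw [ENNReal.ofReal_add (by positivity) (by positivity), ENNReal.ofReal_mul (by norm_num),
            ENNReal.ofReal_mul (by positivity), ENNReal.ofReal_mul (by norm_num),
            ENNReal.ofReal_ofNat]
        rw [key _ _ _ (by positivity) (by positivity) (by positivity)]
        ring
    _ ≤ _ := by
        gcongr
        -- The oscillation term carries no logarithm; since `l ≥ log 2 > 1/2`, inserting `4 l²` only
        -- enlarges it, and this produces the `8 K` in the constant.
        have h1 : 1 ≤ 4 * l ^ 2 := by nlinarith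
        have h2 : 2 * (K * I.length ^ s) ≤ 2 * (K * I.length ^ s) * (4 * l ^ 2) :=
          le_mul_of_one_le_right (by positivity) h1
        calc _ ≤ 2 * (K * I.length ^ s) * (4 * l ^ 2) +
              2 * ((2 + B) ^ 2 * l ^ 2) * (M * I.length ^ s) := by gcongr
          _ = _ := by ring

theorem IsCarlesonMeasure.idBounded {s t : ℝ} (ht : 0 < t) (hts : t < s) {μ : Measure ℂ}
    (h : IsCarlesonMeasure s μ) : IdBounded t s 2 μ := by
  obtain ⟨M, hM, hμ⟩ := h.exists_measure_tent_le
  obtain ⟨D, hD, hDf⟩ := exists_lintegral_tent_le ht hts hM hμ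
  have hbd : ∀ f ∈ QSpace t, tentNorm s 2 μ f ≤ (Real.toNNReal D ^ (1 / 2 : ℝ) : ℝ≥0) * qNorm t f := by
    intro f hf
    refine iSup_le fun I => ?_
    have hlog := one_le_two_mul_log I
    have hl : 0 < Real.log (2 / I.length) := by linarith
    have hL := Real.rpow_pos_of_pos I.length_pos s
    have h1 : (∫⁻ z in I.tent, ‖f z‖ₑ ^ (2 : ℝ) ∂μ) /
        ENNReal.ofReal (I.length ^ s * Real.log (2 / I.length) ^ (2 : ℝ)) ≤
        ENNReal.ofReal D * qNorm t f ^ 2 := by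
      simp only [ENNReal.rpow_two, Real.rpow_two]
      apply ENNReal.div_le_of_le_mul
      refine (hDf f hf I).trans_eq ?_
      rw [ENNReal.ofReal_mul hD]
      ring
    refine (ENNReal.rpow_le_rpow h1 (by norm_num)).trans_eq ?_
    rw [ENNReal.mul_rpow_of_nonneg _ _ (by norm_num), ← ENNReal.rpow_two, ← ENNReal.rpow_mul,
      ENNReal.coe_rpow_of_nonneg _ (by norm_num)]
    norm_num
    rfl
  refine ⟨fun f hf => ⟨hf.1, (hbd f hf).trans_lt ?_⟩, _, hbd⟩
  exact ENNReal.mul_lt_top ENNReal.coe_lt_top hf.2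

/-! ### Logarithmic test functions and necessity -/

/-- The radial majorant of the `𝒬_t` integrand of a logarithm. -/
noncomputable def logMajorant (t d r : ℝ) : ℝ := d ^ t * r ^ t / (r ^ 2 * max d r ^ (2 * t))

lemma lintegral_rpow_Ioc {t d : ℝ} (ht : 0 < t) (hd : 0 < d) :
    ∫⁻ r in Set.Ioc 0 d, ENNReal.ofReal (r ^ (t - 1)) = ENNReal.ofReal (d ^ t / t) := by
  rw [← ofReal_integral_eq_lintegral_ofReal, ← intervalIntegral.integral_of_le hd.le,
    integral_rpow (Or.inl (by linarith)), sub_add_cancel, Real.zero_rpow ht.ne', sub_zero]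
  · exact (intervalIntegral.intervalIntegrable_rpow' (by linarith)).1
  · filter_upwards [ae_restrict_mem measurableSet_Ioc] with x hx
    exact Real.rpow_nonneg hx.1.le _

lemma lintegral_rpow_Ioi {t d : ℝ} (ht : 0 < t) (hd : 0 < d) :
    ∫⁻ r in Set.Ioi d, ENNReal.ofReal (r ^ (-t - 1)) = ENNReal.ofReal (d ^ (-t) / t) := by
  rw [← ofReal_integral_eq_lintegral_ofReal, integral_Ioi_rpow_of_lt (by linarith) hd,
    sub_add_cancel, neg_div_neg_eq]
  · exact integrableOn_Ioi_rpow_of_lt (by linarith) hd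
  · filter_upwards [ae_restrict_mem measurableSet_Ioi] with x hx
    exact Real.rpow_nonneg (hd.trans hx).le _

lemma measurable_logMajorant (t d : ℝ) : Measurable (logMajorant t d) := by
  unfold logMajorant; fun_prop

/-- In polar coordinates the radial density is `d^{-t} r^{t-1}` up to `d` and `d^t r^{-t-1}` beyond
it. Each piece integrates to `1 / t`, so the bound does not depend on `d`. -/
lemma lintegral_logMajorant_norm {t d : ℝ} (ht : 0 < t) (hd : 0 < d) :
    ∫⁻ u : ℂ, ENNReal.ofReal (logMajorant t d ‖u‖) ≤ ENNReal.ofReal (4 * Real.pi / t) := by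
  have hpi := Real.pi_pos
  rw [lintegral_eq_polar (f := fun u : ℂ => ENNReal.ofReal (logMajorant t d ‖u‖))
    (ENNReal.measurable_ofReal.comp ((measurable_logMajorant t d).comp measurable_norm))]
  have h1 : ∀ r ∈ Set.Ioi (0 : ℝ), ENNReal.ofReal r * ∫⁻ θ in Set.Ioo (-Real.pi) Real.pi,
      ENNReal.ofReal (logMajorant t d ‖(r : ℂ) * Complex.exp (θ * Complex.I)‖) =
      ENNReal.ofReal (2 * Real.pi) * ENNReal.ofReal (r * logMajorant t d r) := by
    intro r hr
    simp only [norm_mul, Complex.norm_exp_ofReal_mul_I, mul_one, Complex.norm_real,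
      Real.norm_of_nonneg (Set.mem_Ioi.1 hr).le]
    rw [setLIntegral_const, Real.volume_Ioo, ENNReal.ofReal_mul (Set.mem_Ioi.1 hr).le,
      show Real.pi - -Real.pi = 2 * Real.pi by ring]
    ring
  rw [setLIntegral_congr_fun measurableSet_Ioi h1, lintegral_const_mul' _ _ ENNReal.ofReal_ne_top,
    ← Set.Ioc_union_Ioi_eq_Ioi hd.le, lintegral_union measurableSet_Ioi (Set.Ioc_disjoint_Ioi le_rfl)]
  have h2 : ∫⁻ r in Set.Ioc 0 d, ENNReal.ofReal (r * logMajorant t d r) =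
      ENNReal.ofReal (d ^ (-t)) * ENNReal.ofReal (d ^ t / t) := by
    rw [← lintegral_rpow_Ioc ht hd, ← lintegral_const_mul' _ _ ENNReal.ofReal_ne_top]
    refine setLIntegral_congr_fun measurableSet_Ioc fun r hr => ?_
    have hr0 := hr.1
    rw [← ENNReal.ofReal_mul (by positivity)]
    congr 1
    rw [logMajorant, max_eq_left hr.2, two_mul, Real.rpow_add hd, Real.rpow_sub_one hr0.ne',
      Real.rpow_neg hd.le]
    field_simp
  have h3 : ∫⁻ r in Set.Ioi d, ENNReal.ofReal (r * logMajorant t d r) =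
      ENNReal.ofReal (d ^ t) * ENNReal.ofReal (d ^ (-t) / t) := by
    rw [← lintegral_rpow_Ioi ht hd, ← lintegral_const_mul' _ _ ENNReal.ofReal_ne_top]
    refine setLIntegral_congr_fun measurableSet_Ioi fun r hr => ?_
    have hr0 := hd.trans hr
    rw [← ENNReal.ofReal_mul (by positivity)]
    congr 1
    rw [logMajorant, max_eq_right (le_of_lt hr), two_mul, Real.rpow_add hr0,
      Real.rpow_sub_one hr0.ne', Real.rpow_neg hr0.le]
    field_simp
  have h4 : d ^ (-t) * (d ^ t / t) = 1 / t := by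
    rw [Real.rpow_neg hd.le]; field_simp
  have h5 : d ^ t * (d ^ (-t) / t) = 1 / t := by
    rw [Real.rpow_neg hd.le]; field_simp
  rw [h2, h3, ← ENNReal.ofReal_mul (by positivity), ← ENNReal.ofReal_mul (by positivity), h4, h5,
    ← ENNReal.ofReal_add (by positivity) (by positivity), ← ENNReal.ofReal_mul (by positivity)]
  apply le_of_eq; congr 1; ring

/-- Take `α = a / |a|` (and `α = 1` for `a = 0`). Passing from `a` to `α` changes `1 - conj a * z`
by at most `1 - |a|`, which is itself at most `|1 - conj a * z|`. Thus the denominators can be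
replaced by distances to a boundary point. -/
lemma exists_unimodular (a : ℂ) (ha : ‖a‖ < 1) :
    ∃ α : ℂ, ‖α‖ = 1 ∧ ∀ z : ℂ, ‖z‖ < 1 → ‖α - z‖ ≤ 2 * ‖1 - (starRingEnd ℂ) a * z‖ := by
  refine ⟨Complex.exp (a.arg * Complex.I), Complex.norm_exp_ofReal_mul_I _, fun z hz => ?_⟩
  set α := Complex.exp (a.arg * Complex.I) with hα
  have hα1 : ‖α‖ = 1 := Complex.norm_exp_ofReal_mul_I _
  have haα : (‖a‖ : ℂ) * α = a := Complex.norm_mul_exp_arg_mul_I a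
  have hαα : (starRingEnd ℂ) α * α = 1 := by rw [Complex.conj_mul', hα1]; simp
  have h1 : ‖α - z‖ = ‖1 - (starRingEnd ℂ) α * z‖ := by
    rw [← hαα, ← mul_sub, norm_mul, RCLike.norm_conj, hα1, one_mul]
  have h2 : 1 - (starRingEnd ℂ) α * z =
      (1 - (starRingEnd ℂ) a * z) - ((1 - ‖a‖ : ℝ) : ℂ) * ((starRingEnd ℂ) α * z) := by
    rw [← haα, map_mul, Complex.conj_ofReal, norm_mul, hα1, Complex.norm_real, norm_norm, mul_one]
    push_cast; ring
  have h3 : ‖((1 - ‖a‖ : ℝ) : ℂ) * ((starRingEnd ℂ) α * z)‖ ≤ 1 - ‖a‖ := by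
    rw [norm_mul, norm_mul, RCLike.norm_conj, hα1, one_mul, Complex.norm_real,
      Real.norm_of_nonneg (by linarith)]
    exact mul_le_of_le_one_right (by linarith) hz.le
  have h4 : 1 - ‖a‖ ≤ ‖1 - (starRingEnd ℂ) a * z‖ := by
    have := norm_sub_norm_le (1 : ℂ) ((starRingEnd ℂ) a * z)
    rw [norm_one, norm_mul, RCLike.norm_conj] at this
    nlinarith [norm_nonneg a]
  rw [h1, h2]
  refine (norm_sub_le _ _).trans ?_
  linarith

/-- Here `h` stands for `1 - |z|`, `X` and `Y` for the denominators of the logarithm and of the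
Möbius weight, and `r` for a distance to a boundary point. Everything is replaced by its bound in
`r` and `d`, leaving a radial function. -/
lemma div_le_logMajorant {t d h r X Y : ℝ} (ht : 0 < t) (hd : 0 < d) (hh : 0 ≤ h) (hr : 0 < r)
    (hhr : h ≤ r) (hrX : r ≤ 2 * X) (hY : max d r ≤ 2 * Y) :
    X⁻¹ ^ 2 * (4 * (d * h) / Y ^ 2) ^ t ≤ 4 * 16 ^ t * logMajorant t d r := by
  have hm : 0 < max d r := lt_max_of_lt_left hd
  have hX0 : 0 < X := by linarith
  have hY0 : 0 < Y := by linarith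
  have h1 : (4 * (d * h) / Y ^ 2) ^ t ≤ 16 ^ t * (d ^ t * r ^ t) / max d r ^ (2 * t) := by
    have h2 : 16 ^ t * (d ^ t * r ^ t) / max d r ^ (2 * t) = (16 * (d * r) / max d r ^ 2) ^ t := by
      rw [Real.div_rpow (by positivity) (by positivity), Real.mul_rpow (by norm_num) (by positivity),
        Real.mul_rpow hd.le hr.le, ← Real.rpow_natCast (max d r) 2, ← Real.rpow_mul hm.le]
      norm_num
    rw [h2]
    apply Real.rpow_le_rpow (by positivity) _ ht.le
    rw [div_le_div_iff₀ (by positivity) (by positivity)]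
    calc 4 * (d * h) * max d r ^ 2 ≤ 4 * (d * r) * (2 * Y) ^ 2 := by gcongr
      _ = _ := by ring
  have h3 : X⁻¹ ^ 2 ≤ 4 / r ^ 2 := by
    rw [inv_pow, inv_eq_one_div, div_le_div_iff₀ (by positivity) (by positivity)]
    nlinarith
  calc X⁻¹ ^ 2 * (4 * (d * h) / Y ^ 2) ^ t
      ≤ 4 / r ^ 2 * (16 ^ t * (d ^ t * r ^ t) / max d r ^ (2 * t)) := by gcongr
    _ = _ := by rw [logMajorant]; field_simp

/-- A logarithm with its singularity near the boundary. -/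
noncomputable def logTest (b z : ℂ) : ℂ := Real.log 16 - Complex.log (1 - (starRingEnd ℂ) b * z)

lemma hasDerivAt_logTest {b z : ℂ} (hb : ‖b‖ < 1) (hz : ‖z‖ < 1) :
    HasDerivAt (logTest b) ((starRingEnd ℂ) b / (1 - (starRingEnd ℂ) b * z)) z := by
  have hre : 0 < (1 - (starRingEnd ℂ) b * z).re := by
    have h1 : ((starRingEnd ℂ) b * z).re ≤ ‖(starRingEnd ℂ) b * z‖ := Complex.re_le_norm _
    rw [norm_mul, RCLike.norm_conj] at h1
    rw [Complex.sub_re, Complex.one_re]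
    nlinarith [norm_nonneg b, norm_nonneg z]
  have h2 : HasDerivAt (fun z => 1 - (starRingEnd ℂ) b * z) (-(starRingEnd ℂ) b) z := by
    simpa using ((hasDerivAt_id z).const_mul ((starRingEnd ℂ) b)).const_sub 1
  have h3 := (h2.clog (Or.inl hre)).const_sub (Real.log 16 : ℂ)
  rwa [neg_div, neg_neg] at h3

/-- The integrand has two centres, near `b` and near `a`. It is dominated by the sum of two radial
majorants about the corresponding boundary points, whose integrals depend neither on `a` nor on `b`.
-/
lemma lintegral_logTest_le {t : ℝ} (ht : 0 < t) {a b : ℂ} (ha : ‖a‖ < 1) (hb : ‖b‖ < 1) :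
    ∫⁻ z in disc, ENNReal.ofReal (‖deriv (logTest b) z‖ ^ 2 * (1 - ‖discAut a z‖ ^ 2) ^ t) ≤
      ENNReal.ofReal (4 * 16 ^ t * (8 * Real.pi / t)) := by
  obtain ⟨α, hα, hα2⟩ := exists_unimodular a ha
  obtain ⟨β, hβ, hβ2⟩ := exists_unimodular b hb
  set d := 1 - ‖a‖ with hd
  have hd0 : 0 < d := by linarith
  have hpi := Real.pi_pos
  have hint : ∀ γ : ℂ, ∫⁻ z, ENNReal.ofReal (logMajorant t d ‖γ - z‖) ≤
      ENNReal.ofReal (4 * Real.pi / t) := by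
    intro γ
    rw [lintegral_sub_left_eq_self (fun u : ℂ => ENNReal.ofReal (logMajorant t d ‖u‖)) γ]
    exact lintegral_logMajorant_norm ht hd0
  have hm0 : ∀ r : ℝ, 0 ≤ r → 0 ≤ logMajorant t d r := by
    intro r hr
    have : 0 < max d r := lt_max_of_lt_left hd0
    unfold logMajorant; positivity
  have hpt : ∀ z ∈ disc, ENNReal.ofReal
      (‖deriv (logTest b) z‖ ^ 2 * (1 - ‖discAut a z‖ ^ 2) ^ t) ≤
      ENNReal.ofReal (4 * 16 ^ t) * (ENNReal.ofReal (logMajorant t d ‖β - z‖) +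
        ENNReal.ofReal (logMajorant t d ‖α - z‖)) := by
    intro z hz
    rw [mem_disc] at hz
    rw [← ENNReal.ofReal_add (hm0 _ (norm_nonneg _)) (hm0 _ (norm_nonneg _)),
      ← ENNReal.ofReal_mul (by positivity)]
    apply ENNReal.ofReal_le_ofReal
    have hX := norm_one_sub_conj_mul_pos hb hz
    have hY := norm_one_sub_conj_mul_pos ha hz
    set X := ‖1 - (starRingEnd ℂ) b * z‖ with hXd
    set Y := ‖1 - (starRingEnd ℂ) a * z‖ with hYd
    have hx := hβ2 z hz
    have hy := hα2 z hz
    have hdY : d ≤ Y := by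
      have := norm_sub_norm_le (1 : ℂ) ((starRingEnd ℂ) a * z)
      rw [norm_one, norm_mul, RCLike.norm_conj] at this
      nlinarith [norm_nonneg a]
    have hdist : ∀ γ : ℂ, ‖γ‖ = 1 → 1 - ‖z‖ ≤ ‖γ - z‖ := by
      intro γ hγ
      have := norm_sub_norm_le γ z
      rwa [hγ] at this
    have hder : ‖deriv (logTest b) z‖ ≤ X⁻¹ := by
      rw [(hasDerivAt_logTest hb hz).deriv, norm_div, RCLike.norm_conj, ← hXd, div_eq_mul_inv]
      exact mul_le_of_le_one_left (by positivity) hb.le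
    have hφ : 1 - ‖discAut a z‖ ^ 2 ≤ 4 * (d * (1 - ‖z‖)) / Y ^ 2 := by
      rw [one_sub_norm_discAut_sq ha hz]
      refine div_le_div_of_nonneg_right ?_ (by positivity)
      have h1 : 1 - ‖a‖ ^ 2 ≤ 2 * d := by nlinarith [norm_nonneg a]
      have h2 : 1 - ‖z‖ ^ 2 ≤ 2 * (1 - ‖z‖) := by nlinarith [norm_nonneg z]
      have h3 : 0 ≤ 1 - ‖z‖ ^ 2 := by nlinarith [norm_nonneg z]
      calc _ ≤ 2 * d * (2 * (1 - ‖z‖)) := by gcongr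
        _ = _ := by ring
    have hle : ‖deriv (logTest b) z‖ ^ 2 * (1 - ‖discAut a z‖ ^ 2) ^ t ≤
        X⁻¹ ^ 2 * (4 * (d * (1 - ‖z‖)) / Y ^ 2) ^ t := by
      have := one_sub_norm_discAut_sq_nonneg ha hz
      gcongr
    refine hle.trans ?_
    -- Centre the majorant at the boundary point belonging to the smaller denominator; twice that
    -- denominator bounds `r`, so twice the other one does too.
    rcases le_total X Y with h | h
    · refine (div_le_logMajorant (r := ‖β - z‖) ht hd0 (by linarith)
        ((sub_pos.2 hz).trans_le (hdist β hβ)) (hdist β hβ) hx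
        (max_le (by linarith) (by linarith))).trans ?_
      gcongr
      linarith [hm0 _ (norm_nonneg (α - z))]
    · refine (div_le_logMajorant (r := ‖α - z‖) ht hd0 (by linarith)
        ((sub_pos.2 hz).trans_le (hdist α hα)) (hdist α hα) (by linarith)
        (max_le (by linarith) hy)).trans ?_
      gcongr
      linarith [hm0 _ (norm_nonneg (β - z))]
  calc _ ≤ ∫⁻ z in disc, ENNReal.ofReal (4 * 16 ^ t) *
        (ENNReal.ofReal (logMajorant t d ‖β - z‖) + ENNReal.ofReal (logMajorant t d ‖α - z‖)) :=
        setLIntegral_mono' measurableSet_ball hpt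
    _ ≤ ∫⁻ z, ENNReal.ofReal (4 * 16 ^ t) *
        (ENNReal.ofReal (logMajorant t d ‖β - z‖) + ENNReal.ofReal (logMajorant t d ‖α - z‖)) :=
        setLIntegral_le_lintegral _ _
    _ = ENNReal.ofReal (4 * 16 ^ t) * ((∫⁻ z, ENNReal.ofReal (logMajorant t d ‖β - z‖)) +
          ∫⁻ z, ENNReal.ofReal (logMajorant t d ‖α - z‖)) := by
        rw [lintegral_const_mul' _ _ ENNReal.ofReal_ne_top, lintegral_add_left]
        exact ENNReal.measurable_ofReal.comp ((measurable_logMajorant t d).comp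
          (by fun_prop : Measurable fun z : ℂ => ‖β - z‖))
    _ ≤ ENNReal.ofReal (4 * 16 ^ t) *
        (ENNReal.ofReal (4 * Real.pi / t) + ENNReal.ofReal (4 * Real.pi / t)) := by
        gcongr
        · exact hint β
        · exact hint α
    _ = _ := by
        rw [← ENNReal.ofReal_add (by positivity) (by positivity),
          ← ENNReal.ofReal_mul (by positivity)]
        congr 1; ring

/-- The logarithms `logTest b` are uniformly bounded in `𝒬_t`. -/
lemma exists_qNorm_logTest_le {t : ℝ} (ht : 0 < t) :
    ∃ C : ℝ≥0, ∀ b : ℂ, ‖b‖ < 1 → qNorm t (logTest b) ≤ C := by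
  refine ⟨‖(Real.log 16 : ℂ)‖₊ +
    Real.toNNReal (4 * 16 ^ t * (8 * Real.pi / t)) ^ (1 / 2 : ℝ), fun b hb => ?_⟩
  rw [ENNReal.coe_add, ENNReal.coe_rpow_of_nonneg _ (by norm_num), qNorm]
  gcongr
  · simp [logTest, enorm]
  · refine iSup₂_le fun a ha => ?_
    exact ENNReal.rpow_le_rpow (lintegral_logTest_le ht (mem_disc.1 ha) hb) (by norm_num)

lemma logTest_mem_QSpace {t : ℝ} (ht : 0 < t) {b : ℂ} (hb : ‖b‖ < 1) : logTest b ∈ QSpace t := by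
  obtain ⟨C, hC⟩ := exists_qNorm_logTest_le ht
  exact ⟨fun z hz => (hasDerivAt_logTest hb (mem_disc.1 hz)).differentiableAt.differentiableWithinAt,
    (hC b hb).trans_lt ENNReal.coe_lt_top⟩

/-- On the tent `|1 - conj a * z| ≤ 8 |I|` for the apex `a`, and the constant `16` is chosen so that
`log 16 - log (8 |I|)` is exactly `log (2 / |I|)`. Taking the real part avoids the argument of the
logarithm. -/
lemma log_le_norm_logTest (I : Subarc) {z : ℂ} (hz : z ∈ I.tent) :
    Real.log (2 / I.length) ≤ ‖logTest I.apex z‖ := by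
  have hL0 := I.length_pos
  have hz0 := I.pos_of_mem_tent hz
  have hζ := I.norm_of_mem_carrier hz.2.2
  have hpos := norm_one_sub_conj_mul_pos I.norm_apex_lt_one hz.2.1
  have h1 := norm_one_sub_conj_mul_le (w := z) I.norm_apex_lt_one.le
  have h2 := I.norm_apex_sub_le hz.2.2
  have h3 : ‖((1 - I.length : ℝ) : ℂ) * (z / (‖z‖ : ℂ)) - z‖ ≤ I.length := by
    have h4 : ((1 - I.length : ℝ) : ℂ) * (z / (‖z‖ : ℂ)) - z =
        ((1 - I.length - ‖z‖ : ℝ) : ℂ) * (z / (‖z‖ : ℂ)) := by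
      rw [Complex.ofReal_sub _ ‖z‖, sub_mul,
        mul_div_cancel₀ _ (by exact_mod_cast hz0.ne' : (‖z‖ : ℂ) ≠ 0)]
    rw [h4, norm_mul, hζ, mul_one, Complex.norm_real, Real.norm_eq_abs, abs_le]
    constructor <;> linarith [hz.1, hz.2.1]
  have h5 := norm_sub_le_norm_sub_add_norm_sub I.apex
    (((1 - I.length : ℝ) : ℂ) * (z / (‖z‖ : ℂ))) z
  rw [I.norm_apex] at h1
  have h6 : ‖1 - (starRingEnd ℂ) I.apex * z‖ ≤ 8 * I.length := by linarith
  have h7 := Real.log_le_log hpos h6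
  have h8 : Real.log (2 / I.length) = Real.log 16 - Real.log (8 * I.length) := by
    rw [← Real.log_div (by norm_num) (by positivity)]
    congr 1; field_simp; norm_num
  have h9 : (logTest I.apex z).re = Real.log 16 - Real.log ‖1 - (starRingEnd ℂ) I.apex * z‖ := by
    rw [logTest, Complex.sub_re, Complex.ofReal_re, Complex.log_re]
  linarith [Complex.re_le_norm (logTest I.apex z)]

theorem IdBounded.isCarlesonMeasure {s t : ℝ} (ht : 0 < t) {μ : Measure ℂ}
    (h : IdBounded t s 2 μ) : IsCarlesonMeasure s μ := by
  obtain ⟨C, hC⟩ := exists_qNorm_logTest_le ht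
  obtain ⟨-, C', hC'⟩ := h
  refine lt_of_le_of_lt (iSup_le fun I => ?_) (ENNReal.coe_lt_top (r := (C' * C) ^ 2))
  have hb := I.norm_apex_lt_one
  have hL := Real.rpow_pos_of_pos I.length_pos s
  have hlog := one_le_two_mul_log I
  set l := Real.log (2 / I.length) with hl
  have hl0 : 0 < l := by linarith
  have h1 : ((∫⁻ z in I.tent, ‖logTest I.apex z‖ₑ ^ (2 : ℝ) ∂μ) /
      ENNReal.ofReal (I.length ^ s * l ^ (2 : ℝ))) ^ (1 / 2 : ℝ) ≤ C' * C :=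
    (le_iSup (fun I : Subarc => ((∫⁻ z in I.tent, ‖logTest _ z‖ₑ ^ (2 : ℝ) ∂μ) /
      ENNReal.ofReal (I.length ^ s * Real.log (2 / I.length) ^ (2 : ℝ))) ^ (1 / 2 : ℝ)) I).trans
      ((hC' _ (logTest_mem_QSpace ht hb)).trans (by gcongr; exact hC _ hb))
  have h2 := ENNReal.rpow_le_rpow h1 (by norm_num : (0 : ℝ) ≤ 2)
  rw [← ENNReal.rpow_mul, one_div, inv_mul_cancel₀ (by norm_num), ENNReal.rpow_one] at h2
  simp only [ENNReal.rpow_two, Real.rpow_two] at h2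
  have h3 : ENNReal.ofReal (l ^ 2) * μ I.tent ≤ ∫⁻ z in I.tent, ‖logTest I.apex z‖ₑ ^ 2 ∂μ := by
    rw [← setLIntegral_const]
    apply setLIntegral_mono' I.measurableSet_tent
    intro z hz
    rw [enorm_sq_eq_ofReal]
    apply ENNReal.ofReal_le_ofReal
    have := log_le_norm_logTest I hz
    gcongr
  have hl2 : ENNReal.ofReal (l ^ 2) ≠ 0 := by simpa using hl0.ne'
  have hL2 : ENNReal.ofReal (I.length ^ s) ≠ 0 := by simpa using hL
  -- The lower bound `l²` for the test function cancels the logarithmic factor of the tent norm.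
  have h4 : μ I.tent / ENNReal.ofReal (I.length ^ s) ≤
      (∫⁻ z in I.tent, ‖logTest I.apex z‖ₑ ^ 2 ∂μ) / ENNReal.ofReal (I.length ^ s * l ^ 2) := by
    rw [mul_comm (I.length ^ s), ENNReal.ofReal_mul (by positivity),
      ← ENNReal.mul_div_mul_left _ _ hl2 ENNReal.ofReal_ne_top]
    gcongr
  push_cast
  exact h4.trans h2

end CarlesonEmbedding

theorem mainTheorem1 (t s : ℝ) (ht : 0 < t) (hts : t < s) (hs : s ≤ 1)
    (μ : MeasureTheory.Measure ℂ) (hμ : μ (CarlesonEmbedding.disc)ᶜ = 0) :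
    CarlesonEmbedding.IdBounded t s 2 μ ↔ CarlesonEmbedding.IsCarlesonMeasure s μ :=
  ⟨fun h => h.isCarlesonMeasure ht, fun h => h.idBounded ht hts⟩
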